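/- Let $P\subset\mathbb{R}^d$ be a closed convex cone with $P-P=\mathbb{R}^d$ and $P\cap(-P)=\{0\}$, and let $\Omega$ be its interior. Hilbert spaces are complex and separable, with inner products $\langle\cdot|\cdot\rangle$ linear in the first variable. An isometric representation of $P$ on $\mathcal{H}$ is a strongly continuous semigroup $V=\{V_x\}_{x\in P}$ of isometries of $\mathcal{H}$; it is pure if $\bigcap_{x\in P}V_x\mathcal{H}=\{0\}$. Its CCR flow $\alpha^V=\{\alpha^V_x\}_{x\in P}$ is the semigroup of unital normal $*$-endomorphisms of $B(\Gamma(\mathcal{H}))$, $\Gamma(\mathcal{H})$ being the symmetric Fock space, determined by $\alpha^V_x(W(\xi))=W(V_x\xi)$ for the Weyl operators $W(\xi)$. Families $\alpha$ on $B(\mathcal{H}_1)$ and $\beta$ on $B(\mathcal{H}_2)$ are cocycle conjugate if there are a unitary $U:\mathcal{H}_1\to\mathcal{H}_2$ and a strongly continuous family of unitaries $\{C_x\}_{x\in P}$ on $\mathcal{H}_1$ with $C_0=1$, $C_{x+y}=C_x\alpha_x(C_y)$ and $\beta_x(UAU^*)=U\,C_x\alpha_x(A)C_x^*\,U^*$ for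 all $x\in P$, $A\in B(\mathcal{H}_1)$. **Theorem.** Let $V$ and $W$ be pure isometric representations of $P$. The CCR flows $\alpha^V$ and $\alpha^W$ are cocycle conjugate if and only if $V$ and $W$ are unitarily equivalent. Moreover, $\alpha^V$ is decomposable, and the isometric representation of $\Omega$ constructed from it is unitarily equivalent to $V|_\Omega$. In detail, for $\alpha=\alpha^V$ and $x\in P$ let $E(x)=\{T:\alpha_x(A)T=TA\ \text{for all } A\}$, a Hilbert space with $\langle S|T\rangle 1=T^*S$, and let $D(x)$ be the set of decomposable vectors, i.e. of nonzero $u\in E(x)$ such that whenever $x=y+z$ with $y,z\in P$ there are $v\in E(y)$, $w\in E(z)$ with $u=vw$. A section $(u_x)_{x\in P}$, $u_x\in D(x)$, is left coherent if $u_{y+z}\in u_yD(z)$ for all $y,z\in P$. Let $\Delta(x)$ be $D(x)$ modulo nonzero scalars. Then: 1. $D(x)D(y)\subset D(x+y)$ for $x,y\in P$, and $D(x)$ is total in $E(x)$ for every $x\in P$. 2. There is a left coherent section $e=(e_x)_{x\in P}$ of decomposable vectors of norm one. 3. For each such $e$ there is a unique function $L^e(a,u,v)$ of $a\in\Omega$,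 $u,v\in\Delta(a)$ with $$e^{L^e(a,u,v)}=\frac{\langle u|v\rangle}{\langle u|e_a\rangle\langle e_a|v\rangle}$$ such that, for all left coherent sections $(u_x)$, $(v_x)$ of decomposable vectors, $a\mapsto L^e(a,u_a,v_a)$ is continuous on $\Omega$ and tends to $0$ as $a\to 0$ in $\Omega$. 4. For each such $e$ the following construction is possible. Let $H_a$ ($a\in\Omega$) be the completion, modulo null vectors, of the space of finitely supported functions on $\Delta(a)$ with sum zero, with the form $\langle f|g\rangle=\sum_{u,v}f(u)\overline{g(v)}L^e(a,u,v)$, and write $[u]-[v]$ for the class of $\delta_u-\delta_v$. Let $H_\infty$ be the inductive limit of the $H_a$ along the isometric embeddings $H_a\to H_{a+c}$, $[u]-[v]\mapsto[uf]-[vf]$, where $f\in D(c)$ is arbitrary ($a,c\in\Omega$). Let $\widetilde V_a$ ($a\in\Omega$) be the isometry of $H_\infty$ with $[u]-[v]\mapsto[fu]-[fv]$ for $u,v\in D(b)$, $b\in\Omega$, where $f\in D(a)$ is arbitrary. There is a unitary $U:\mathcal{H}\to H_\infty$ with $UV_aU^*=\widetilde V_a$ for every $a\in\Omega$. -/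

import Mathlib

universe u v w

noncomputable section

namespace CCR

open scoped TensorProduct InnerProductSpace

section Fock
variable (H : Type u) [NormedAddCommGroup H] [InnerProductSpace ℂ H]

/-- A bundled complex inner product space. -/
structure PreHilbert : Type (u + 1) where
  carrier : Type u
  [normed : NormedAddCommGroup carrier]
  [inner : InnerProductSpace ℂ carrier]

attribute [instance] PreHilbert.normed PreHilbert.inner

/-- The algebraic tensor power `H ⊗ ⋯ ⊗ H` (`n` factors) with its inner product. The zeroth power
is `ℂ` (as a one-dimensional Euclidean space, so that it lives in the universe of `H`). -/
def tensorPow : ℕ → PreHilbert.{u}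
  | 0 => ⟨EuclideanSpace ℂ PUnit.{u + 1}⟩
  | n + 1 => ⟨H ⊗[ℂ] (tensorPow n).carrier⟩

variable {H}

/-- The elementary tensor `ξ ⊗ ⋯ ⊗ ξ` (`n` factors). -/
def tensorPowVec (ξ : H) : ∀ n, (tensorPow H n).carrier
  | 0 => (EuclideanSpace.single PUnit.unit 1 : EuclideanSpace ℂ PUnit.{u + 1})
  | n + 1 => (ξ ⊗ₜ[ℂ] tensorPowVec ξ n : H ⊗[ℂ] (tensorPow H n).carrier)

theorem inner_tensorPowVec (ξ η : H) (n : ℕ) :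
    ⟪tensorPowVec ξ n, tensorPowVec η n⟫_ℂ = ⟪ξ, η⟫_ℂ ^ n := by
  induction n with
  | zero =>
    change ⟪(EuclideanSpace.single PUnit.unit 1 : EuclideanSpace ℂ PUnit.{u + 1}),
      EuclideanSpace.single PUnit.unit 1⟫_ℂ = _
    simp
  | succ n ih =>
    change ⟪(ξ ⊗ₜ[ℂ] tensorPowVec ξ n : H ⊗[ℂ] (tensorPow H n).carrier),
      η ⊗ₜ[ℂ] tensorPowVec η n⟫_ℂ = _
    rw [TensorProduct.inner_tmul, ih, pow_succ']

variable (H) in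
/-- The full Fock space `⨁ₙ H^{⊗n}` (Hilbert space direct sum of the completed tensor powers). -/
abbrev FullFock : Type u := lp (fun n => UniformSpace.Completion (tensorPow H n).carrier) 2

theorem norm_tensorPowVec (ξ : H) (n : ℕ) : ‖tensorPowVec ξ n‖ = ‖ξ‖ ^ n := by
  have h := inner_tensorPowVec ξ ξ n
  rw [inner_self_eq_norm_sq_to_K, inner_self_eq_norm_sq_to_K] at h
  have h' : ‖tensorPowVec ξ n‖ ^ 2 = (‖ξ‖ ^ n) ^ 2 := by
    rw [← pow_mul, mul_comm, pow_mul]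
    exact_mod_cast h
  exact (pow_left_inj₀ (norm_nonneg _) (by positivity) two_ne_zero).1 h'

/-- The sequence `(ξ^{⊗n} / √n!)ₙ`. -/
def fullExpFun (ξ : H) (n : ℕ) : UniformSpace.Completion (tensorPow H n).carrier :=
  ((Real.sqrt n.factorial)⁻¹ : ℂ) • (tensorPowVec ξ n : UniformSpace.Completion _)

theorem inner_fullExpFun (ξ η : H) (n : ℕ) :
    ⟪fullExpFun ξ n, fullExpFun η n⟫_ℂ = ⟪ξ, η⟫_ℂ ^ n / n.factorial := by
  have h : ((Real.sqrt n.factorial : ℝ) : ℂ) ^ 2 = n.factorial := by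
    rw [← Complex.ofReal_pow, Real.sq_sqrt (by positivity)]; simp
  rw [fullExpFun, fullExpFun, inner_smul_left, inner_smul_right,
    UniformSpace.Completion.inner_coe, inner_tensorPowVec, map_inv₀, Complex.conj_ofReal, ← h]
  ring

theorem memℓp_fullExpFun (ξ : H) : Memℓp (fullExpFun ξ) 2 := by
  apply memℓp_gen
  have h : ∀ n, ‖fullExpFun ξ n‖ ^ (2 : ENNReal).toReal = (‖ξ‖ ^ 2) ^ n / n.factorial := by
    intro n
    have h := inner_fullExpFun ξ ξ n
    rw [inner_self_eq_norm_sq_to_K, inner_self_eq_norm_sq_to_K] at h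
    simp only [ENNReal.toReal_ofNat, Real.rpow_two]
    have h' : ((‖fullExpFun ξ n‖ ^ 2 : ℝ) : ℂ) = (((‖ξ‖ ^ 2) ^ n / n.factorial : ℝ) : ℂ) := by
      simpa using h
    exact Complex.ofReal_injective h'
  simp_rw [h]
  exact Real.summable_pow_div_factorial _

/-- The exponential vector `e(ξ) = (ξ^{⊗n} / √n!)ₙ` in the full Fock space. -/
def fullExp (ξ : H) : FullFock H := ⟨fullExpFun ξ, memℓp_fullExpFun ξ⟩

theorem inner_fullExp (ξ η : H) : ⟪fullExp ξ, fullExp η⟫_ℂ = Complex.exp ⟪ξ, η⟫_ℂ := by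
  rw [lp.inner_eq_tsum, Complex.exp_eq_exp_ℂ, NormedSpace.exp_eq_tsum_div]
  exact tsum_congr fun n => inner_fullExpFun ξ η n

variable (H) in
/-- The symmetric Fock space `Γ(H)`: the closed linear span of the exponential vectors in the full
Fock space. As the tensors `ξ^{⊗n}` span the symmetric tensors, this is the Hilbert space direct sum
of the symmetric tensor powers of `H`. -/
def fockSubmodule : Submodule ℂ (FullFock H) :=
  (Submodule.span ℂ (Set.range (fullExp (H := H)))).topologicalClosure

variable (H) in
/-- The symmetric Fock space `Γ(H)` as a type. -/
def Fock : Type u := fockSubmodule H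

instance : NormedAddCommGroup (Fock H) := inferInstanceAs (NormedAddCommGroup (fockSubmodule H))
instance : InnerProductSpace ℂ (Fock H) :=
  inferInstanceAs (InnerProductSpace ℂ (fockSubmodule H))
instance : CompleteSpace (Fock H) :=
  (Submodule.isClosed_topologicalClosure _).completeSpace_coe

/-- The exponential vector `e(ξ)` in the symmetric Fock space. -/
def expVec (ξ : H) : Fock H :=
  ⟨fullExp ξ, Submodule.le_topologicalClosure _ (Submodule.subset_span ⟨ξ, rfl⟩)⟩

theorem inner_expVec (ξ η : H) : ⟪expVec ξ, expVec η⟫_ℂ = Complex.exp ⟪ξ, η⟫_ℂ :=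
  inner_fullExp ξ η

theorem dense_span_expVec :
    Dense (Submodule.span ℂ (Set.range (expVec (H := H))) : Set (Fock H)) := by
  intro x
  let p : Submodule ℂ (fockSubmodule H) := Submodule.span ℂ (Set.range (expVec (H := H)))
  change x ∈ closure (p : Set (fockSubmodule H))
  have h : Subtype.val '' (p : Set (fockSubmodule H))
      = (Submodule.span ℂ (Set.range (fullExp (H := H))) : Set (FullFock H)) := by
    refine (p.map_coe (fockSubmodule H).subtype).symm.trans ?_
    refine congrArg _ ((Submodule.map_span _ _).trans ?_)
    exact congrArg _ (Set.range_comp (fockSubmodule H).subtype (expVec (H := H))).symm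
  rw [Topology.IsEmbedding.subtypeVal.closure_eq_preimage_closure_image, h]
  exact x.2

end Fock

section Extension
open scoped ComplexOrder
variable {X : Type*} {E F : Type*} [NormedAddCommGroup E] [InnerProductSpace ℂ E]
  [NormedAddCommGroup F] [InnerProductSpace ℂ F]

theorem inner_linearCombination (f : X → E) (c : X →₀ ℂ) :
    ⟪Finsupp.linearCombination ℂ f c, Finsupp.linearCombination ℂ f c⟫_ℂ =
      c.sum fun i s => c.sum fun j t => star s * Matrix.gram ℂ f i j * t := by
  simp only [Finsupp.linearCombination_apply, Finsupp.sum, sum_inner]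
  refine Finset.sum_congr rfl fun i _ => ?_
  rw [inner_sum]
  refine Finset.sum_congr rfl fun j _ => ?_
  simp [inner_smul_left, inner_smul_right, Matrix.gram_apply, mul_comm]

theorem posSemidef_gram (f : X → E) : (Matrix.gram ℂ f).PosSemidef := by
  refine ⟨Matrix.isHermitian_gram ℂ f, fun c => ?_⟩
  rw [← inner_linearCombination, inner_self_eq_norm_sq_to_K]
  simp

/-- A family of vectors whose Gram matrix is dominated by that of a total family is the image of
the latter under a bounded operator. -/
theorem exists_clm_of_gram_le [CompleteSpace F] (f : X → E) (g : X → F)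
    (hf : Dense (Submodule.span ℂ (Set.range f) : Set E)) (C : ℝ) (hC : 0 ≤ C)
    (h : (((C : ℂ) ^ 2) • Matrix.gram ℂ f - Matrix.gram ℂ g).PosSemidef) :
    ∃ T : E →L[ℂ] F, ∀ x, T (f x) = g x := by
  have hd : DenseRange (Finsupp.linearCombination ℂ f) := by
    rw [DenseRange, ← LinearMap.coe_range, Finsupp.range_linearCombination]
    exact hf
  have hle : ∀ c : X →₀ ℂ,
      ‖Finsupp.linearCombination ℂ g c‖ ≤ C * ‖Finsupp.linearCombination ℂ f c‖ := by
    intro c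
    have h1 := h.2 c
    have h2 : (c.sum fun i s => c.sum fun j t =>
        star s * (((C : ℂ) ^ 2) • Matrix.gram ℂ f - Matrix.gram ℂ g) i j * t) =
        (C : ℂ) ^ 2 * ⟪Finsupp.linearCombination ℂ f c, Finsupp.linearCombination ℂ f c⟫_ℂ
          - ⟪Finsupp.linearCombination ℂ g c, Finsupp.linearCombination ℂ g c⟫_ℂ := by
      rw [inner_linearCombination, inner_linearCombination]
      simp only [Finsupp.sum, Finset.mul_sum, ← Finset.sum_sub_distrib]
      refine Finset.sum_congr rfl fun i _ => Finset.sum_congr rfl fun j _ => ?_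
      simp only [Matrix.sub_apply, Matrix.smul_apply, smul_eq_mul]
      ring
    rw [h2, inner_self_eq_norm_sq_to_K, inner_self_eq_norm_sq_to_K] at h1
    have h3 : (0 : ℂ) ≤ ((C ^ 2 * ‖Finsupp.linearCombination ℂ f c‖ ^ 2
        - ‖Finsupp.linearCombination ℂ g c‖ ^ 2 : ℝ) : ℂ) := by
      push_cast
      exact h1
    rw [Complex.zero_le_real, ← mul_pow] at h3
    exact (sq_le_sq₀ (norm_nonneg _) (by positivity)).1 (by linarith)
  refine ⟨(Finsupp.linearCombination ℂ g).extendOfNorm (Finsupp.linearCombination ℂ f), fun x => ?_⟩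
  have := LinearMap.extendOfNorm_eq (f := Finsupp.linearCombination ℂ g) hd ⟨C, hle⟩
    (Finsupp.single x 1)
  simpa using this

end Extension

section Total
variable {X : Type*} {E F : Type*} [NormedAddCommGroup E] [InnerProductSpace ℂ E]
  [NormedAddCommGroup F] [InnerProductSpace ℂ F]

theorem clm_ext_of_dense {f : X → E} (hf : Dense (Submodule.span ℂ (Set.range f) : Set E))
    {S T : E →L[ℂ] F} (h : ∀ x, S (f x) = T (f x)) : S = T :=
  ContinuousLinearMap.ext_on hf (by rintro _ ⟨x, rfl⟩; exact h x)

end Total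

section Weyl
open scoped ComplexOrder
variable {H : Type u} [NormedAddCommGroup H] [InnerProductSpace ℂ H]

theorem exists_weyl (ξ : H) : ∃ T : Fock H →L[ℂ] Fock H, ∀ η,
    T (expVec η) = Complex.exp (-(‖ξ‖ ^ 2 : ℝ) / 2 - ⟪ξ, η⟫_ℂ) • expVec (ξ + η) := by
  refine exists_clm_of_gram_le _ _ dense_span_expVec 1 zero_le_one ?_
  convert Matrix.PosSemidef.zero using 1
  ext i j
  have h : ⟪ξ, ξ⟫_ℂ = ((‖ξ‖ ^ 2 : ℝ) : ℂ) := by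
    rw [inner_self_eq_norm_sq_to_K]; simp
  simp only [Matrix.sub_apply, Matrix.smul_apply, Matrix.gram_apply, inner_smul_left,
    inner_smul_right, inner_expVec, ← Complex.exp_conj, Matrix.zero_apply, smul_eq_mul]
  rw [← Complex.exp_add, ← Complex.exp_add, sub_eq_zero]
  simp only [inner_add_left, inner_add_right, map_sub, inner_conj_symm, h, map_div₀, map_neg,
    Complex.conj_ofReal, map_ofNat]
  simp only [Complex.ofReal_one, one_pow, one_mul]
  congr 1
  ring

/-- The Weyl operator `W(ξ)`, with `W(ξ) e(η) = exp(-‖ξ‖²/2 - ⟨η|ξ⟩) e(ξ + η)`, where `⟨η|ξ⟩` is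
linear in `η`, i.e. equals `⟪ξ, η⟫_ℂ`. -/
def weyl (ξ : H) : Fock H →L[ℂ] Fock H := (exists_weyl ξ).choose

theorem weyl_expVec (ξ η : H) : weyl ξ (expVec η) =
    Complex.exp (-(‖ξ‖ ^ 2 : ℝ) / 2 - ⟪ξ, η⟫_ℂ) • expVec (ξ + η) :=
  (exists_weyl ξ).choose_spec η

variable (v : H →ₗᵢ[ℂ] H)

theorem inner_range_orthogonal (ξ : (LinearMap.range v.toLinearMap)ᗮ) (η : H) :
    ⟪v η, (ξ : H)⟫_ℂ = 0 :=
  ξ.2 _ (LinearMap.mem_range_self v.toLinearMap η)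

theorem inner_orthogonal_range (ξ : (LinearMap.range v.toLinearMap)ᗮ) (η : H) :
    ⟪(ξ : H), v η⟫_ℂ = 0 :=
  inner_eq_zero_symm.1 (inner_range_orthogonal v ξ η)

theorem exists_fockShift (ξ : (LinearMap.range v.toLinearMap)ᗮ) :
    ∃ T : Fock H →L[ℂ] Fock H, ∀ η, T (expVec η) = expVec ((ξ : H) + v η) := by
  refine exists_clm_of_gram_le _ _ dense_span_expVec (Real.exp (‖(ξ : H)‖ ^ 2 / 2))
    (Real.exp_pos _).le ?_
  convert Matrix.PosSemidef.zero using 1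
  ext i j
  have h1 : ⟪(ξ : H), v j⟫_ℂ = 0 := inner_orthogonal_range v ξ j
  have h2 : ⟪v i, (ξ : H)⟫_ℂ = 0 := inner_range_orthogonal v ξ i
  have h : ⟪(ξ : H), (ξ : H)⟫_ℂ = ((‖(ξ : H)‖ ^ 2 : ℝ) : ℂ) := by
    rw [inner_self_eq_norm_sq_to_K]; simp
  simp only [Matrix.sub_apply, Matrix.smul_apply, Matrix.gram_apply, inner_expVec,
    Matrix.zero_apply, smul_eq_mul, inner_add_left, inner_add_right, h1, h2, h,
    LinearIsometry.inner_map_map, Complex.ofReal_exp, ← Complex.exp_nat_mul, ← Complex.exp_add]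
  rw [sub_eq_zero]
  congr 1
  push_cast
  ring

/-- For `ξ ∈ ker v* = (range v)ᗮ`, the operator on `Γ(H)` with `e(η) ↦ e(ξ + v η)`. -/
def fockShift (ξ : (LinearMap.range v.toLinearMap)ᗮ) : Fock H →L[ℂ] Fock H :=
  (exists_fockShift v ξ).choose

theorem fockShift_expVec (ξ : (LinearMap.range v.toLinearMap)ᗮ) (η : H) :
    fockShift v ξ (expVec η) = expVec ((ξ : H) + v η) :=
  (exists_fockShift v ξ).choose_spec η

theorem adjoint_fockShift_mul (ξ ζ : (LinearMap.range v.toLinearMap)ᗮ) :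
    star (fockShift v ξ) * fockShift v ζ = Complex.exp ⟪(ξ : H), (ζ : H)⟫_ℂ • 1 := by
  refine clm_ext_of_dense dense_span_expVec fun η => ?_
  refine (dense_span_expVec (H := H)).eq_of_inner_right ℂ ?_
  intro x hx
  induction hx using Submodule.span_induction with
  | zero => simp
  | add x y _ _ hx hy => rw [inner_add_left, inner_add_left, hx, hy]
  | smul a x _ hx => rw [inner_smul_left, inner_smul_left, hx]
  | mem x hx =>
    obtain ⟨η', rfl⟩ := hx
    have h1 : ⟪(ξ : H), v η⟫_ℂ = 0 := inner_orthogonal_range v ξ η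
    have h2 : ⟪v η', (ζ : H)⟫_ℂ = 0 := inner_range_orthogonal v ζ η'
    rw [ContinuousLinearMap.star_eq_adjoint, mul_apply_eq_comp,
      ContinuousLinearMap.adjoint_inner_right, fockShift_expVec, fockShift_expVec, inner_expVec]
    simp [inner_smul_right, inner_expVec, h1, h2, Complex.exp_add]

theorem inner_fockShift (ξ ζ : (LinearMap.range v.toLinearMap)ᗮ) (a b : Fock H) :
    ⟪fockShift v ξ a, fockShift v ζ b⟫_ℂ = Complex.exp ⟪(ξ : H), (ζ : H)⟫_ℂ * ⟪a, b⟫_ℂ := by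
  rw [← ContinuousLinearMap.adjoint_inner_right, ← ContinuousLinearMap.star_eq_adjoint,
    ← mul_apply_eq_comp, adjoint_fockShift_mul]
  simp [inner_smul_right]

variable [CompleteSpace H]

theorem dense_span_fockShift : Dense (Submodule.span ℂ (Set.range
    fun p : (LinearMap.range v.toLinearMap)ᗮ × H => fockShift v p.1 (expVec p.2)) :
      Set (Fock H)) := by
  refine (dense_span_expVec (H := H)).mono (Submodule.span_mono ?_)
  rintro _ ⟨η, rfl⟩
  have hc : IsComplete (LinearMap.range v.toLinearMap : Set H) := by
    rw [LinearMap.coe_range]; exact v.isometry.isUniformInducing.isComplete_range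
  have : CompleteSpace (LinearMap.range v.toLinearMap) := hc.completeSpace_coe
  obtain ⟨y, ⟨z, rfl⟩, w, hw, rfl⟩ :=
    (LinearMap.range v.toLinearMap).exists_add_mem_mem_orthogonal η
  exact ⟨(⟨w, hw⟩, z), (fockShift_expVec v _ _).trans (congrArg expVec (add_comm _ _))⟩

theorem fockShift_ext {S T : Fock H →L[ℂ] Fock H}
    (h : ∀ ξ, S * fockShift v ξ = T * fockShift v ξ) : S = T :=
  clm_ext_of_dense (dense_span_fockShift v) fun p => DFunLike.congr_fun (h p.1) (expVec p.2)

theorem exists_ccrEnd (A : Fock H →L[ℂ] Fock H) :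
    ∃ B : Fock H →L[ℂ] Fock H, ∀ ξ, B * fockShift v ξ = fockShift v ξ * A := by
  obtain ⟨B, hB⟩ := exists_clm_of_gram_le _
    (fun p : (LinearMap.range v.toLinearMap)ᗮ × H => fockShift v p.1 (A (expVec p.2)))
    (dense_span_fockShift v) ‖A‖ (norm_nonneg _) (by
      have h1 := posSemidef_gram
        fun p : (LinearMap.range v.toLinearMap)ᗮ × H => expVec (p.1 : H)
      have h2 := Matrix.posSemidef_opNorm_smul_gram_sub_gram (𝕜 := ℂ)
        (fun p : (LinearMap.range v.toLinearMap)ᗮ × H => expVec p.2) A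
      have key : ((‖A‖ : ℂ) ^ 2) • Matrix.gram ℂ
            (fun p : (LinearMap.range v.toLinearMap)ᗮ × H => fockShift v p.1 (expVec p.2)) -
          Matrix.gram ℂ
            (fun p : (LinearMap.range v.toLinearMap)ᗮ × H => fockShift v p.1 (A (expVec p.2))) =
          (Matrix.gram ℂ fun p : (LinearMap.range v.toLinearMap)ᗮ × H => expVec (p.1 : H)).hadamard
            (‖A‖ ^ 2 • (Matrix.gram ℂ fun p : (LinearMap.range v.toLinearMap)ᗮ × H =>
              expVec p.2) - Matrix.gram ℂ (A ∘ fun p => expVec p.2)) := by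
        ext p q
        simp only [Matrix.sub_apply, Matrix.smul_apply, Matrix.gram_apply, inner_fockShift,
          inner_expVec, Matrix.hadamard_apply, Function.comp_apply, smul_eq_mul, Complex.real_smul]
        push_cast
        ring
      rw [key]
      exact h1.hadamard h2)
  refine ⟨B, fun ξ => clm_ext_of_dense dense_span_expVec fun η => ?_⟩
  exact hB (ξ, η)

/-- The value at `A` of the endomorphism of `B(Γ(H))` induced by the isometry `v`. -/
def ccrEndFun (A : Fock H →L[ℂ] Fock H) : Fock H →L[ℂ] Fock H := (exists_ccrEnd v A).choose

theorem ccrEndFun_mul (A : Fock H →L[ℂ] Fock H) (ξ : (LinearMap.range v.toLinearMap)ᗮ) :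
    ccrEndFun v A * fockShift v ξ = fockShift v ξ * A :=
  (exists_ccrEnd v A).choose_spec ξ

/-- The `*`-endomorphism of `B(Γ(H))` induced by an isometry `v` of `H`. Under the unitary
`Γ(ker v*) ⊗ Γ(H) → Γ(H)`, `e(ξ) ⊗ e(η) ↦ e(ξ + v η)`, it is `A ↦ 1 ⊗ A`; equivalently it is the
unique map with `α(A) T_ξ = T_ξ A` for all `ξ ∈ ker v*`, where `T_ξ e(η) = e(ξ + v η)`. It is also
the unique normal `*`-endomorphism with `W(ξ) ↦ W(v ξ)`. -/
def ccrEnd : (Fock H →L[ℂ] Fock H) →⋆ₐ[ℂ] (Fock H →L[ℂ] Fock H) where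
  toFun := ccrEndFun v
  map_one' := fockShift_ext v fun ξ => by rw [ccrEndFun_mul, mul_one, one_mul]
  map_zero' := fockShift_ext v fun ξ => by rw [ccrEndFun_mul, mul_zero, zero_mul]
  map_mul' A B := fockShift_ext v fun ξ => by
    rw [ccrEndFun_mul, mul_assoc, ccrEndFun_mul, ← mul_assoc, ← mul_assoc, ccrEndFun_mul]
  map_add' A B := fockShift_ext v fun ξ => by
    rw [ccrEndFun_mul, add_mul, ccrEndFun_mul, ccrEndFun_mul, mul_add]
  commutes' c := fockShift_ext v fun ξ => by
    rw [ccrEndFun_mul, Algebra.commutes]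
  map_star' A := by
    have h : ∀ ξ ζ : (LinearMap.range v.toLinearMap)ᗮ,
        star (fockShift v ζ) * ccrEndFun v (star A) * fockShift v ξ =
          star (fockShift v ζ) * star (ccrEndFun v A) * fockShift v ξ := by
      intro ξ ζ
      rw [mul_assoc, ccrEndFun_mul, ← star_mul, ccrEndFun_mul, star_mul, mul_assoc,
        adjoint_fockShift_mul, ← mul_assoc, adjoint_fockShift_mul]
      simp
    refine fockShift_ext v fun ξ => ?_
    rw [← star_inj]
    refine fockShift_ext v fun ζ => ?_
    have := congrArg star (h ξ ζ)
    simpa [mul_assoc] using this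

theorem ccrEnd_mul_fockShift (A : Fock H →L[ℂ] Fock H) (ξ : (LinearMap.range v.toLinearMap)ᗮ) :
    ccrEnd v A * fockShift v ξ = fockShift v ξ * A :=
  ccrEndFun_mul v A ξ

/-- The defining property of the CCR construction: `W(ξ) ↦ W(v ξ)`. -/
theorem ccrEnd_weyl (ξ : H) : ccrEnd v (weyl ξ) = weyl (v ξ) := by
  refine fockShift_ext v fun ζ => clm_ext_of_dense dense_span_expVec fun η => ?_
  have h : ⟪v ξ, (ζ : H)⟫_ℂ = 0 := inner_range_orthogonal v ζ ξ
  rw [ccrEnd_mul_fockShift]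
  simp only [mul_apply_eq_comp, weyl_expVec, fockShift_expVec, map_smul, map_add,
    inner_add_right, h, LinearIsometry.norm_map, LinearIsometry.inner_map_map, zero_add]
  rw [add_left_comm]

end Weyl
section Semigroups

variable {E : Type*} [NormedAddCommGroup E] [NormedSpace ℝ E] (P : PointedCone ℝ E)

/-- An isometric representation of the cone `P` on `H`: a strongly continuous semigroup of
isometries of `H` indexed by `P`. -/
structure IsometricRep (H : Type*) [NormedAddCommGroup H] [InnerProductSpace ℂ H] where
  toFun : P → H →ₗᵢ[ℂ] H
  map_zero : ∀ ξ, toFun 0 ξ = ξ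
  map_add : ∀ x y ξ, toFun (x + y) ξ = toFun x (toFun y ξ)
  continuous : ∀ ξ, Continuous fun x => toFun x ξ

/-- The interior `Ω` of the cone `P`, as a subtype of `P`. -/
abbrev ConeInterior : Type _ := {a : P // (a : E) ∈ interior (P : Set E)}

variable {P}

open scoped Pointwise in
instance : Add (ConeInterior P) where
  add a b := ⟨a.1 + b.1, by
    have h : interior (P : Set E) + (P : Set E) ⊆ interior (P : Set E) :=
      (subset_interior_add_left).trans (interior_mono (by
        rintro _ ⟨x, hx, y, hy, rfl⟩; exact P.add_mem hx hy))
    exact h (Set.add_mem_add a.2 b.1.2)⟩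

section Rep
variable {H : Type u} [NormedAddCommGroup H] [InnerProductSpace ℂ H]
  {K : Type v} [NormedAddCommGroup K] [InnerProductSpace ℂ K]

/-- `V` is pure if `⋂ₓ Vₓ H = {0}`. -/
def IsometricRep.IsPure (V : IsometricRep P H) : Prop :=
  ⋂ x, Set.range (V.toFun x) = {0}

/-- Unitary equivalence of isometric representations. -/
def UnitarilyEquivalent (V : IsometricRep P H) (W : IsometricRep P K) : Prop :=
  ∃ U : H ≃ₗᵢ[ℂ] K, ∀ x ξ, U (V.toFun x ξ) = W.toFun x (U ξ)

end Rep

/-- A family of unital `*`-endomorphisms of `B(𝓗)` indexed by `P`. -/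
abbrev EndFamily (P : PointedCone ℝ E) (𝓗 : Type*) [NormedAddCommGroup 𝓗] [InnerProductSpace ℂ 𝓗]
    [CompleteSpace 𝓗] : Type _ :=
  P → (𝓗 →L[ℂ] 𝓗) →⋆ₐ[ℂ] (𝓗 →L[ℂ] 𝓗)

/-- The CCR flow `α^V` on `B(Γ(H))` associated with `V`; it satisfies `αₓ(W(ξ)) = W(Vₓ ξ)`. -/
def ccrFlow {H : Type u} [NormedAddCommGroup H] [InnerProductSpace ℂ H] [CompleteSpace H]
    (V : IsometricRep P H) : EndFamily P (Fock H) :=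
  fun x => ccrEnd (V.toFun x)

theorem ccrFlow_weyl {H : Type u} [NormedAddCommGroup H] [InnerProductSpace ℂ H] [CompleteSpace H]
    (V : IsometricRep P H) (x : P) (ξ : H) : ccrFlow V x (weyl ξ) = weyl (V.toFun x ξ) :=
  ccrEnd_weyl _ _

variable {𝓗 : Type u} [NormedAddCommGroup 𝓗] [InnerProductSpace ℂ 𝓗] [CompleteSpace 𝓗]
  {𝓚 : Type v} [NormedAddCommGroup 𝓚] [InnerProductSpace ℂ 𝓚] [CompleteSpace 𝓚]

/-- A unitary cocycle of `α`: a strongly continuous family of unitaries with `C₀ = 1` and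
`C_{x+y} = Cₓ αₓ(C_y)`. -/
structure IsUnitaryCocycle (α : EndFamily P 𝓗) (C : P → 𝓗 →L[ℂ] 𝓗) : Prop where
  mem_unitary : ∀ x, C x ∈ unitary (𝓗 →L[ℂ] 𝓗)
  map_zero : C 0 = 1
  map_add : ∀ x y, C (x + y) = C x * α x (C y)
  continuous : ∀ ξ, Continuous fun x => C x ξ

/-- `α` and `β` are cocycle conjugate: up to a unitary `U : 𝓗 → 𝓚`, the family `β` is the
perturbation `Cₓ αₓ(·) Cₓ*` of `α` by a unitary cocycle. -/
def CocycleConjugate (α : EndFamily P 𝓗) (β : EndFamily P 𝓚) : Prop :=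
  ∃ (C : P → 𝓗 →L[ℂ] 𝓗) (U : 𝓗 ≃ₗᵢ[ℂ] 𝓚), IsUnitaryCocycle α C ∧
    ∀ x (A : 𝓗 →L[ℂ] 𝓗) (ξ : 𝓗),
      β x (U.toContinuousLinearEquiv ∘L A ∘L U.symm.toContinuousLinearEquiv) (U ξ) =
        U ((C x * α x A * star (C x)) ξ)

variable (α : EndFamily P 𝓗)

/-- The fibre `E(x) = {T : αₓ(A) T = T A for all A}` of the product system of `α`. -/
def fiber (x : P) : Submodule ℂ (𝓗 →L[ℂ] 𝓗) where
  carrier := {T | ∀ A, α x A * T = T * A}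
  add_mem' hS hT A := by rw [mul_add, add_mul, hS A, hT A]
  zero_mem' A := by rw [mul_zero, zero_mul]
  smul_mem' c T hT A := by rw [mul_smul_comm, smul_mul_assoc, hT A]

/-- The inner product `⟨S|T⟩` of two elements of a fibre: the scalar `T* S`. -/
def fiberInner (S T : 𝓗 →L[ℂ] 𝓗) : ℂ :=
  open Classical in if h : ∃ c : ℂ, star T * S = c • 1 then h.choose else 0

/-- `u ∈ E(x)` is decomposable if it is nonzero and factorises along every `y + z = x`. -/
def IsDecomposableVector (x : P) (u : 𝓗 →L[ℂ] 𝓗) : Prop :=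
  u ∈ fiber α x ∧ u ≠ 0 ∧
    ∀ y z : P, y + z = x → ∃ v ∈ fiber α y, ∃ w ∈ fiber α z, u = v * w

/-- The set `D(x)` of decomposable vectors in `E(x)`. -/
abbrev DecVec (x : P) : Type u := {u : 𝓗 →L[ℂ] 𝓗 // IsDecomposableVector α x u}

/-- `α` is decomposable: `D(x) D(y) ⊆ D(x + y)`, and `D(x)` is total in `E(x)`. (The Hilbert space
norm of `E(x)` is the operator norm, as `‖T‖² 1 = T* T`.) -/
def IsDecomposable : Prop :=
  (∀ (x y : P) (u : DecVec α x) (v : DecVec α y), IsDecomposableVector α (x + y) (u.1 * v.1)) ∧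
  ∀ x : P, (fiber α x : Set (𝓗 →L[ℂ] 𝓗)) ⊆
    closure (Submodule.span ℂ {u | IsDecomposableVector α x u})

variable {α} in
/-- Left coherent sections of decomposable vectors: for `y ≤ x`, `u_y` is a left divisor of `u_x`,
with a decomposable vector as the other factor. -/
def IsLeftCoherent (u : ∀ x : P, DecVec α x) : Prop :=
  ∀ y z : P, ∃ w : DecVec α z, (u (y + z)).1 = (u y).1 * w.1

variable {α} in
/-- Left coherent sections of decomposable vectors of norm one. -/
def IsUnitSection (e : ∀ x : P, DecVec α x) : Prop :=
  IsLeftCoherent e ∧ ∀ x, fiberInner (e x).1 (e x).1 = 1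

/-- Proportionality of decomposable vectors. -/
instance proportional (x : P) : Setoid (DecVec α x) where
  r u v := ∃ c : ℂ, c ≠ 0 ∧ u.1 = c • v.1
  iseqv :=
    { refl := fun u => ⟨1, one_ne_zero, (one_smul ℂ u.1).symm⟩
      symm := by
        rintro u v ⟨c, hc, h⟩
        exact ⟨c⁻¹, inv_ne_zero hc, by rw [h, inv_smul_smul₀ hc]⟩
      trans := by
        rintro u v w ⟨c, hc, h⟩ ⟨d, hd, h'⟩
        exact ⟨c * d, mul_ne_zero hc hd, by rw [h, h', mul_smul]⟩ }

/-- The path space `Δ(x) = D(x) / proportionality`. -/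
abbrev PathSpace (x : P) : Type u := Quotient (proportional α x)

variable {α} in
/-- The class in `Δ(x)` of a decomposable vector. -/
abbrev pathClass {x : P} (u : DecVec α x) : PathSpace α x := Quotient.mk (proportional α x) u

/-- Functions on `Δ^{(2)} = {(a, u, v) : a ∈ Ω, u, v ∈ Δ(a)}`. -/
abbrev PathKernel : Type _ := ∀ a : ConeInterior P, PathSpace α a.1 → PathSpace α a.1 → ℂ

variable {α}

/-- `L` is an `e`-logarithm: it is continuous and vanishes at the origin along pairs of left
coherent sections, and `exp L(a, u, v) = ⟨u|v⟩ / (⟨u|eₐ⟩ ⟨eₐ|v⟩)`. -/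
structure IsELogarithm (e : ∀ x : P, DecVec α x) (L : PathKernel α) : Prop where
  continuous : ∀ u v : ∀ x : P, DecVec α x, IsLeftCoherent u → IsLeftCoherent v →
    Continuous fun a : ConeInterior P => L a (pathClass (u a.1)) (pathClass (v a.1))
  vanishes : ∀ u v : ∀ x : P, DecVec α x, IsLeftCoherent u → IsLeftCoherent v →
    Filter.Tendsto (fun a : ConeInterior P => L a (pathClass (u a.1)) (pathClass (v a.1)))
      (Filter.comap (fun a : ConeInterior P => (a.1 : E)) (nhds 0)) (nhds 0)
  exp_eq : ∀ (a : ConeInterior P) (u v : DecVec α a.1),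
    Complex.exp (L a (pathClass u) (pathClass v)) =
      fiberInner u.1 v.1 / (fiberInner u.1 (e a.1).1 * fiberInner (e a.1).1 v.1)

variable (α) in
/-- `ℂ₀Δ(a)`: finitely supported functions on `Δ(a)` whose sum is zero. -/
def zeroSum (a : ConeInterior P) : Submodule ℂ (PathSpace α a.1 →₀ ℂ) :=
  LinearMap.ker (Finsupp.linearCombination ℂ fun _ : PathSpace α a.1 => (1 : ℂ))

/-- The element `δ_u - δ_v` of `ℂ₀Δ(a)`. -/
def pathDiff {a : ConeInterior P} (u v : DecVec α a.1) : zeroSum α a :=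
  ⟨Finsupp.single (pathClass u) 1 - Finsupp.single (pathClass v) 1, by simp [zeroSum]⟩

/-- The form `⟨f|g⟩ = ∑_{u, v} f(u) conj(g(v)) L(a, u, v)` on `ℂ₀Δ(a)`. -/
def pathForm (L : PathKernel α) (a : ConeInterior P) (f g : zeroSum α a) : ℂ :=
  f.1.sum fun u s => g.1.sum fun v t => s * star t * L a u v

/-- The Hilbert space `K` with the isometries `(Sₐ)_{a ∈ Ω}` is the isometric representation
`(H_∞, (Ṽₐ)_{a ∈ Ω})` constructed from the decomposable family `α` and the kernel `L`. The maps
`ι a : ℂ₀Δ(a) → K` preserve the forms, so that the closure of the range of `ι a` is the completion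
`Hₐ` of `ℂ₀Δ(a)` modulo null vectors. The embeddings `Hₐ ⊆ H_b`, for `b - a ∈ Ω`, are given by
`[u] - [v] ↦ [u f] - [v f]` with `f ∈ D(b - a)`; `K` is the inductive limit of the `Hₐ`, i.e. the
closure of their union; and `Sₐ` maps `[u] - [v]` to `[f u] - [f v]`, where `f ∈ D(a)`. These data
determine `(K, S)` up to a unique unitary compatible with the maps `ι a`. -/
def IsPathRep {K : Type w} [NormedAddCommGroup K] [InnerProductSpace ℂ K]
    (L : PathKernel α) (S : ConeInterior P → K →ₗᵢ[ℂ] K) : Prop :=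
  ∃ ι : ∀ a : ConeInterior P, zeroSum α a →ₗ[ℂ] K,
    (∀ a f g, ⟪ι a g, ι a f⟫_ℂ = pathForm L a f g) ∧
    (∀ (a c : ConeInterior P) (f : DecVec α c.1) (u v : DecVec α a.1)
      (u' v' : DecVec α (a + c).1), u'.1 = u.1 * f.1 → v'.1 = v.1 * f.1 →
        ι (a + c) (pathDiff u' v') = ι a (pathDiff u v)) ∧
    Dense (⋃ a, (LinearMap.range (ι a) : Set K)) ∧
    ∀ (a b : ConeInterior P) (f : DecVec α a.1) (u v : DecVec α b.1)
      (u' v' : DecVec α (a + b).1), u'.1 = f.1 * u.1 → v'.1 = f.1 * v.1 →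
        S a (ι b (pathDiff u v)) = ι (a + b) (pathDiff u' v')

end Semigroups
end CCR

end

noncomputable section

namespace CCR

open scoped InnerProductSpace

/-! ### Sums of orthogonal vectors -/

section Orthogonal
variable {E : Type*} [NormedAddCommGroup E] [InnerProductSpace ℂ E]

/-! A fibre element `T` of `α^V` is determined by the Fock vector `T e(0)`, and products of fibre
elements reflect the splitting of `H` into `ker Vₓ*` and `Vₓ H`. The vectors `V.shift x ξ`, that is
`e(η) ↦ e(ξ + Vₓ η)` with `ξ ∈ ker Vₓ*`, are decomposable. The heart of the proof is the converse of
Araki–Woods type, `exists_eq_smul_shift`: every decomposable vector is a multiple of one of these.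
Along the ray `t ↦ t x` the projections onto `ker V_{tx}*` form a nest without jumps, and
decomposability makes `η ↦ ⟪e(η), u e(0)⟫` multiplicative along it. Cutting `[0, 1]` finely, each
factor is `1 + ⟪D, ξ⟫` up to an error, where `D` is the increment of `η` and `ξ` is the one-particle
component of the normalised vector; the errors are negligible in total because the higher components
of different increments are orthogonal. In the limit the product is `exp ⟪η, ξ⟫`
(`IsNest.exists_exp_eq`).

Hence decomposable vectors have logarithmic coordinates (`LogCoord`): modulo scalars they are the
vectors of `ker Vₓ*`, a product `u v` has coordinate `vec u + Vₓ (vec v)`, and inner products are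
exponentials up to scalar factors. Along a left coherent section the coordinates are compatible
projections, hence continuous. So `⟨vec u - vec eₐ | vec v - vec eₐ⟩` is an `e`-logarithm. It is the
only one, because two logarithms differ along a ray by a continuous function with values in `2πiℤ`
that tends to `0` (`eq_of_isELogarithm`). Sending `[u] - [v]` to `vec u - vec v` then realises the
constructed representation on `H` itself, purity giving density (`isPathRep`), and any other
realisation has the same Gram matrix (`exists_unitary_of_isPathRep`).

For the classification, a cocycle conjugacy is an isomorphism of product systems, so it gives `α^V`
a second system of logarithmic coordinates, with values in the space of `W` (`LogCoord.ofCocycle`).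
The `e`-logarithm depends only on `α^V` and `e`, so `V` and `W` restricted to `Ω` realise the same
data and are unitarily equivalent; continuity extends the equivalence to `P`. Conversely, a unitary
equivalence is second quantised, with trivial cocycle. -/

theorem norm_sum_sq_of_orthogonal {ι : Type*} (s : Finset ι) (g : ι → E)
    (h : ∀ i ∈ s, ∀ j ∈ s, i ≠ j → ⟪g i, g j⟫_ℂ = 0) :
    ‖∑ i ∈ s, g i‖ ^ 2 = ∑ i ∈ s, ‖g i‖ ^ 2 := by
  have h1 : ((‖∑ i ∈ s, g i‖ ^ 2 : ℝ) : ℂ) = ((∑ i ∈ s, ‖g i‖ ^ 2 : ℝ) : ℂ) := by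
    have := inner_self_eq_norm_sq_to_K (𝕜 := ℂ) (∑ i ∈ s, g i)
    push_cast
    simp only [Complex.coe_algebraMap] at this
    rw [← this, sum_inner]
    refine Finset.sum_congr rfl fun i hi => ?_
    rw [inner_sum, Finset.sum_eq_single i (fun j hj hji => h i hi j hj hji.symm)
      (fun h => absurd hi h), inner_self_eq_norm_sq_to_K]
    simp
  exact Complex.ofReal_injective h1

/-- A vector has small total overlap with orthogonal vectors of small total norm. -/
theorem sum_norm_inner_le {ι : Type*} (s : Finset ι) (g : ι → E) (x : E)
    (h : ∀ i ∈ s, ∀ j ∈ s, i ≠ j → ⟪g i, g j⟫_ℂ = 0) :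
    ∑ i ∈ s, ‖⟪g i, x⟫_ℂ‖ ≤ √(∑ i ∈ s, ‖g i‖ ^ 2) * ‖x‖ := by
  -- Phases turn the sum of moduli into a single inner product with a sum of orthogonal vectors, so
  -- that Cauchy–Schwarz is applied only once.
  have hc : ∀ z : ℂ, ∃ c : ℂ, ‖c‖ ≤ 1 ∧ c * z = ‖z‖ := by
    intro z
    by_cases hz : z = 0
    · exact ⟨0, by simp, by simp [hz]⟩
    · have hz' : (‖z‖ : ℂ) ≠ 0 := by simpa using hz
      refine ⟨‖z‖ / z, by simp [hz], by field_simp⟩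
  choose c hc1 hc2 using fun i => hc ⟪g i, x⟫_ℂ
  have h1 : ((∑ i ∈ s, ‖⟪g i, x⟫_ℂ‖ : ℝ) : ℂ) = ⟪∑ i ∈ s, (starRingEnd ℂ (c i)) • g i, x⟫_ℂ := by
    rw [sum_inner]
    push_cast
    refine Finset.sum_congr rfl fun i _ => ?_
    rw [inner_smul_left, Complex.conj_conj, hc2]
  have h2 : ∑ i ∈ s, ‖⟪g i, x⟫_ℂ‖ ≤ ‖∑ i ∈ s, (starRingEnd ℂ (c i)) • g i‖ * ‖x‖ := by
    refine le_trans ?_ (norm_inner_le_norm (𝕜 := ℂ) _ _)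
    rw [← h1, Complex.norm_real]
    exact le_abs_self _
  refine h2.trans (mul_le_mul_of_nonneg_right (Real.le_sqrt_of_sq_le ?_) (norm_nonneg _))
  rw [norm_sum_sq_of_orthogonal]
  · refine Finset.sum_le_sum fun i _ => ?_
    rw [norm_smul, mul_pow, RCLike.norm_conj]
    have := pow_le_one₀ (n := 2) (norm_nonneg _) (hc1 i)
    nlinarith [sq_nonneg ‖g i‖]
  · intro i hi j hj hij
    rw [inner_smul_left, inner_smul_right, h i hi j hj hij]; simp

end Orthogonal

/-! ### The one-particle space and the higher components of exponential vectors -/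

section Fock
variable {H : Type u} [NormedAddCommGroup H] [InnerProductSpace ℂ H]

-- Both families have the same Gram matrix, so the comparison of Gram matrices yields a linear map
-- without unfolding the tensor powers.
open scoped ComplexOrder in
theorem exists_oneParticle : ∃ T : H →L[ℂ] FullFock H, ∀ ξ : H,
    T ξ = lp.single 2 1 (fullExpFun ξ 1) := by
  refine exists_clm_of_gram_le (fun ξ : H => ξ) _ ?_ 1 zero_le_one ?_
  · rw [Set.range_id', Submodule.span_univ]; exact dense_univ
  · convert Matrix.PosSemidef.zero using 1
    ext i j
    simp only [Matrix.sub_apply, Matrix.smul_apply, Matrix.gram_apply, lp.inner_single_left,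
      lp.single_apply_self, inner_fullExpFun, Matrix.zero_apply]
    simp

variable (H) in
/-- The embedding of `H` into the full Fock space as the one-particle space. -/
def oneParticle : H →L[ℂ] FullFock H := exists_oneParticle.choose

theorem oneParticle_apply (ξ : H) : oneParticle H ξ = lp.single 2 1 (fullExpFun ξ 1) :=
  exists_oneParticle.choose_spec ξ

theorem inner_oneParticle (ξ η : H) : ⟪oneParticle H ξ, oneParticle H η⟫_ℂ = ⟪ξ, η⟫_ℂ := by
  simp [oneParticle_apply, lp.inner_single_left, inner_fullExpFun]

theorem inner_oneParticle_fullExp (ξ η : H) : ⟪oneParticle H ξ, fullExp η⟫_ℂ = ⟪ξ, η⟫_ℂ := by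
  rw [oneParticle_apply, lp.inner_single_left]
  exact (inner_fullExpFun ξ η 1).trans (by simp)

theorem inner_fullExp_oneParticle (ξ η : H) : ⟪fullExp ξ, oneParticle H η⟫_ℂ = ⟪ξ, η⟫_ℂ := by
  rw [← inner_conj_symm, inner_oneParticle_fullExp, inner_conj_symm]

/-- The component of an exponential vector orthogonal to the vacuum and the one-particle space. -/
def expRemainder (ξ : H) : FullFock H := fullExp ξ - fullExp 0 - oneParticle H ξ

/-- The exponential series without its first two terms. It vanishes at `0`, so remainders of
orthogonal vectors are orthogonal, which is what controls a sum of many of them. -/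
theorem inner_expRemainder (ξ η : H) :
    ⟪expRemainder ξ, expRemainder η⟫_ℂ = Complex.exp ⟪ξ, η⟫_ℂ - 1 - ⟪ξ, η⟫_ℂ := by
  simp only [expRemainder, inner_sub_left, inner_sub_right, inner_fullExp, inner_oneParticle,
    inner_oneParticle_fullExp, inner_fullExp_oneParticle, inner_zero_left, inner_zero_right,
    Complex.exp_zero]
  ring

theorem norm_expRemainder_sq_le (ξ : H) (h : ‖ξ‖ ≤ 1) : ‖expRemainder ξ‖ ^ 2 ≤ (‖ξ‖ ^ 2) ^ 2 := by
  have h1 : ((‖expRemainder ξ‖ : ℂ)) ^ 2 = Complex.exp ⟪ξ, ξ⟫_ℂ - 1 - ⟪ξ, ξ⟫_ℂ := by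
    rw [← inner_expRemainder, inner_self_eq_norm_sq_to_K]; rfl
  have h2 : ‖⟪ξ, ξ⟫_ℂ‖ = ‖ξ‖ ^ 2 := by
    rw [inner_self_eq_norm_sq_to_K]; simp
  have h3 := Complex.norm_exp_sub_one_sub_id_le (x := ⟪ξ, ξ⟫_ℂ)
    (by rw [h2]; exact pow_le_one₀ (norm_nonneg _) h)
  rw [← h1, h2] at h3
  simpa using h3

end Fock

/-- Comparison of one factor `1 + a + r` with `exp a`. The linear terms cancel; the first constant
is `1 + 2`, from `-a ^ 2` and from `‖1 + a‖ ≤ 2`, and the second bounds `exp 1`. -/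
theorem norm_one_add_mul_exp_sub_le {a r : ℂ} (ha : ‖a‖ ≤ 1) :
    ‖(1 + a + r) * Complex.exp (-a) - 1‖ ≤ 3 * ‖a‖ ^ 2 + 3 * ‖r‖ := by
  have h1 := Complex.norm_exp_sub_one_sub_id_le (x := -a) (by simpa using ha)
  rw [norm_neg] at h1
  have h2 : ‖Complex.exp (-a)‖ ≤ 3 := by
    rw [Complex.norm_exp]
    have h3 : (-a).re ≤ 1 := ((Complex.re_le_norm _).trans (by rw [norm_neg])).trans ha
    exact (Real.exp_le_exp.2 h3).trans (by linarith [Real.exp_one_lt_d9])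
  have h4 : (1 + a + r) * Complex.exp (-a) - 1 =
      -a ^ 2 + (1 + a) * (Complex.exp (-a) - 1 - -a) + r * Complex.exp (-a) := by ring
  rw [h4]
  refine (norm_add_le _ _).trans (add_le_add ((norm_add_le _ _).trans ?_) ?_)
  · rw [norm_neg, norm_pow, norm_mul]
    have h5 : ‖1 + a‖ ≤ 2 := (norm_add_le _ _).trans (by rw [norm_one]; linarith)
    nlinarith [norm_nonneg (1 + a), norm_nonneg (Complex.exp (-a) - 1 - -a), sq_nonneg ‖a‖]
  · rw [norm_mul, mul_comm]
    gcongr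

/-! ### Vectors of Fock space that factorise along a continuous nest -/

section Nest
variable {H : Type u} [NormedAddCommGroup H] [InnerProductSpace ℂ H]

theorem continuous_fullExp : Continuous (fullExp (H := H)) := by
  refine continuous_iff_continuousAt.2 fun η => ?_
  rw [ContinuousAt, tendsto_iff_norm_sub_tendsto_zero]
  have h1 : ∀ ξ : H, ‖fullExp ξ - fullExp η‖ = √(Complex.exp ⟪ξ, ξ⟫_ℂ - Complex.exp ⟪ξ, η⟫_ℂ -
      (Complex.exp ⟪η, ξ⟫_ℂ - Complex.exp ⟪η, η⟫_ℂ)).re := by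
    intro ξ
    rw [norm_eq_sqrt_re_inner (𝕜 := ℂ), inner_sub_left, inner_sub_right, inner_sub_right,
      inner_fullExp, inner_fullExp, inner_fullExp, inner_fullExp]
    rfl
  simp_rw [h1]
  have h2 : Continuous fun ξ : H => √(Complex.exp ⟪ξ, ξ⟫_ℂ - Complex.exp ⟪ξ, η⟫_ℂ -
      (Complex.exp ⟪η, ξ⟫_ℂ - Complex.exp ⟪η, η⟫_ℂ)).re := by fun_prop
  simpa using h2.tendsto η

/-- An increasing strongly continuous family of orthogonal projections, starting at zero. -/
structure IsNest (F : ℝ → H →L[ℂ] H) : Prop where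
  comp : ∀ s t η, F s (F t η) = F (min s t) η
  symm : ∀ t η ζ, ⟪F t η, ζ⟫_ℂ = ⟪η, F t ζ⟫_ℂ
  zero : ∀ η, F 0 η = 0
  continuous : ∀ η, Continuous fun t => F t η

/-- The increment of the path `t ↦ F t η` over the `k`-th of `n` subintervals of `[0, 1]`. -/
def nestIncr (F : ℝ → H →L[ℂ] H) (n k : ℕ) : H →L[ℂ] H :=
  F ((k + 1 : ℕ) / n) - F (k / n)

/-- The functional `η ↦ ⟪e(η), τ⟫` factorises along the nest. -/
def FactorsAlong (F : ℝ → H →L[ℂ] H) (τ : FullFock H) : Prop :=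
  ∀ t ∈ Set.Icc (0 : ℝ) 1, ∀ η ζ : H, F 1 η = η → F 1 ζ = ζ →
    ⟪fullExp (F t η + (ζ - F t ζ)), τ⟫_ℂ * ⟪fullExp (F t ζ + (η - F t η)), τ⟫_ℂ =
      ⟪fullExp η, τ⟫_ℂ * ⟪fullExp ζ, τ⟫_ℂ

variable {F : ℝ → H →L[ℂ] H}

namespace IsNest

theorem norm_le (hF : IsNest F) (t : ℝ) (η : H) : ‖F t η‖ ≤ ‖η‖ := by
  have h1 : ‖F t η‖ ^ 2 ≤ ‖η‖ * ‖F t η‖ := by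
    have h2 : ⟪F t η, F t η⟫_ℂ = ⟪η, F t η⟫_ℂ := by rw [hF.symm, hF.comp, min_self]
    have h3 := norm_inner_le_norm (𝕜 := ℂ) η (F t η)
    rw [← h2, inner_self_eq_norm_sq_to_K] at h3
    simpa using h3
  by_cases h : ‖F t η‖ = 0
  · rw [h]; positivity
  · have : 0 < ‖F t η‖ := lt_of_le_of_ne (norm_nonneg _) (Ne.symm h)
    nlinarith

theorem inner_incr_of_le (hF : IsNest F) {s t s' t' : ℝ} (h1 : s ≤ t) (h2 : t ≤ s')
    (h3 : s' ≤ t') (η ζ : H) :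
    ⟪F t η - F s η, F t' ζ - F s' ζ⟫_ℂ = 0 := by
  simp only [inner_sub_left, inner_sub_right, hF.symm, hF.comp]
  rw [min_eq_left (h2.trans h3), min_eq_left h2, min_eq_left ((h1.trans h2).trans h3),
    min_eq_left (h1.trans h2)]
  simp

theorem inner_nestIncr (hF : IsNest F) {n j k : ℕ} (h : j ≠ k) (η ζ : H) :
    ⟪nestIncr F n j η, nestIncr F n k ζ⟫_ℂ = 0 := by
  wlog hjk : j < k generalizing j k η ζ
  · rw [← inner_conj_symm, this h.symm _ _ (lt_of_le_of_ne (not_lt.1 hjk) h.symm), map_zero]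
  refine hF.inner_incr_of_le ?_ ?_ ?_ η ζ
  · gcongr; simp
  · gcongr; exact hjk
  · gcongr; simp

theorem inner_nestIncr_left (hF : IsNest F) (n k : ℕ) (η ζ : H) :
    ⟪nestIncr F n k η, ζ⟫_ℂ = ⟪nestIncr F n k η, nestIncr F n k ζ⟫_ℂ := by
  have h : (k : ℝ) / n ≤ (k + 1 : ℕ) / n := by gcongr; simp
  simp only [nestIncr, sub_apply, inner_sub_left, inner_sub_right, hF.symm,
    hF.comp, min_eq_left h, min_eq_right h, min_self]
  ring

theorem sum_nestIncr (hF : IsNest F) {n : ℕ} (hn : n ≠ 0) (η : H) :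
    ∑ k ∈ Finset.range n, nestIncr F n k η = F 1 η := by
  simp only [nestIncr, sub_apply]
  rw [Finset.sum_range_sub fun k : ℕ => F ((k : ℝ) / n) η]
  have : (n : ℝ) ≠ 0 := by exact_mod_cast hn
  simp [div_self this, hF.zero]

theorem sum_norm_nestIncr_sq_le (hF : IsNest F) {n : ℕ} (hn : n ≠ 0) (η : H) :
    ∑ k ∈ Finset.range n, ‖nestIncr F n k η‖ ^ 2 ≤ ‖η‖ ^ 2 := by
  rw [← norm_sum_sq_of_orthogonal _ _ fun i _ j _ hij => hF.inner_nestIncr hij η η,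
    hF.sum_nestIncr hn]
  have := hF.norm_le 1 η
  gcongr

/-- Uniform continuity on `[0, 1]`. This is where the absence of jumps in the nest enters. -/
theorem exists_nestIncr_le (hF : IsNest F) (η : H) {δ : ℝ} (hδ : 0 < δ) :
    ∃ n : ℕ, n ≠ 0 ∧ ∀ k < n, ‖nestIncr F n k η‖ ≤ δ := by
  have h1 : UniformContinuousOn (fun t => F t η) (Set.Icc 0 1) :=
    isCompact_Icc.uniformContinuousOn_of_continuous (hF.continuous η).continuousOn
  obtain ⟨ε, hε, h2⟩ := Metric.uniformContinuousOn_iff.1 h1 δ hδ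
  obtain ⟨m, hm⟩ := exists_nat_one_div_lt hε
  refine ⟨m + 1, by simp, fun k hk => ?_⟩
  have hk' : ((k + 1 : ℕ) : ℝ) ≤ (m + 1 : ℕ) := by exact_mod_cast hk
  have hpos : (0 : ℝ) < (m + 1 : ℕ) := by positivity
  have h3 := h2 ((k + 1 : ℕ) / (m + 1 : ℕ)) ⟨by positivity, (div_le_one hpos).2 hk'⟩
    (k / (m + 1 : ℕ)) ⟨by positivity, (div_le_one hpos).2 (le_trans (by simp) hk')⟩ (by
      rw [Real.dist_eq, ← sub_div]
      push_cast
      rw [add_sub_cancel_left, abs_of_pos (by positivity)]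
      exact hm)
  rw [dist_eq_norm] at h3
  exact h3.le

theorem apply_one_apply (hF : IsNest F) {t : ℝ} (ht : t ≤ 1) (η : H) : F 1 (F t η) = F t η := by
  rw [hF.comp, min_eq_right ht]

/-- The vector `η` is removed one small increment at a time. Deleting a single increment keeps the
amplitude nonzero by continuity at `η`, and the factorisation passes this on to the tails `η - F t
η`, the last of which is `0`. -/
theorem vacuum_ne_zero (hF : IsNest F) {τ : FullFock H} (hτ : FactorsAlong F τ) {η : H}
    (hη : F 1 η = η)
    (h0 : ⟪fullExp η, τ⟫_ℂ ≠ 0) : ⟪fullExp (0 : H), τ⟫_ℂ ≠ 0 := by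
  have hcont : Continuous fun ζ : H => ⟪fullExp (η - ζ), τ⟫_ℂ :=
    (continuous_fullExp.comp (continuous_const.sub continuous_id)).inner continuous_const
  have h1 : ∀ᶠ ζ in nhds (0 : H), ⟪fullExp (η - ζ), τ⟫_ℂ ≠ 0 :=
    hcont.continuousAt.eventually_ne (by simpa using h0)
  obtain ⟨δ, hδ, h2⟩ := Metric.eventually_nhds_iff.1 h1
  obtain ⟨n, hn, h3⟩ := hF.exists_nestIncr_le η (half_pos hδ)
  have hn' : (0 : ℝ) < n := by exact_mod_cast Nat.pos_of_ne_zero hn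
  have key : ∀ k ≤ n, ⟪fullExp (η - F ((k : ℕ) / n) η), τ⟫_ℂ ≠ 0 := by
    intro k
    induction k with
    | zero => intro _; simpa [hF.zero] using h0
    | succ k ih =>
      intro hk
      have ht : (k : ℝ) / n ∈ Set.Icc (0 : ℝ) 1 :=
        ⟨by positivity, (div_le_one hn').2 (by exact_mod_cast (Nat.le_succ k).trans hk)⟩
      have ht' : ((k + 1 : ℕ) : ℝ) / n ≤ 1 := (div_le_one hn').2 (by exact_mod_cast hk)
      have hle : (k : ℝ) / n ≤ (k + 1 : ℕ) / n := by gcongr; simp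
      -- Exchanging the parts of `η` and of its next tail beyond `k / n` yields `η` without its
      -- `k`-th increment and the current tail.
      have h4 := hτ _ ht η (η - F ((k + 1 : ℕ) / n) η) hη
        (by rw [map_sub, hη, hF.apply_one_apply ht'])
      have h5 : F ((k : ℝ) / n) (η - F ((k + 1 : ℕ) / n) η) = 0 := by
        rw [map_sub, hF.comp, min_eq_left hle, sub_self]
      rw [h5, sub_zero, zero_add] at h4
      have h6 : F ((k : ℝ) / n) η + (η - F ((k + 1 : ℕ) / n) η) = η - nestIncr F n k η := by
        simp only [nestIncr, sub_apply]; abel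
      rw [h6] at h4
      have h7 : ⟪fullExp (η - nestIncr F n k η), τ⟫_ℂ ≠ 0 := by
        apply h2
        rw [dist_zero_right]
        linarith [h3 k hk]
      have h8 := mul_ne_zero h7 (ih ((Nat.le_succ k).trans hk))
      rw [h4] at h8
      exact right_ne_zero_of_mul h8
  have := key n le_rfl
  rwa [div_self hn'.ne', hη, sub_self] at this

/-- Factorisation against the zero vector splits off one increment at a time; the normalisation
removes the vacuum factor that appears at each step. -/
theorem prod_nestIncr (hF : IsNest F) {τ : FullFock H} (hτ : FactorsAlong F τ)
    (h1 : ⟪fullExp (0 : H), τ⟫_ℂ = 1) {n : ℕ} (hn : n ≠ 0) (η : H) :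
    ∏ k ∈ Finset.range n, ⟪fullExp (nestIncr F n k η), τ⟫_ℂ = ⟪fullExp (F 1 η), τ⟫_ℂ := by
  have hn' : (0 : ℝ) < n := by exact_mod_cast Nat.pos_of_ne_zero hn
  have key : ∀ m ≤ n, ∏ k ∈ Finset.range m, ⟪fullExp (nestIncr F n k η), τ⟫_ℂ =
      ⟪fullExp (F ((m : ℕ) / n) η), τ⟫_ℂ := by
    intro m
    induction m with
    | zero => intro _; simp [hF.zero, h1]
    | succ m ih =>
      intro hm
      have ht : (m : ℝ) / n ∈ Set.Icc (0 : ℝ) 1 :=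
        ⟨by positivity, (div_le_one hn').2 (by exact_mod_cast (Nat.le_succ m).trans hm)⟩
      have ht' : ((m + 1 : ℕ) : ℝ) / n ≤ 1 := (div_le_one hn').2 (by exact_mod_cast hm)
      have hle : (m : ℝ) / n ≤ (m + 1 : ℕ) / n := by gcongr; simp
      have h4 := hτ _ ht (F ((m + 1 : ℕ) / n) η) 0 (hF.apply_one_apply ht' η) (map_zero _)
      rw [Finset.prod_range_succ, ih ((Nat.le_succ m).trans hm)]
      rw [hF.comp, min_eq_left hle, map_zero, sub_zero, add_zero, zero_add, h1, mul_one] at h4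
      exact h4
  have := key n le_rfl
  rwa [div_self hn'.ne'] at this

variable [CompleteSpace H]

/-- A vector of the Fock space that factorises along a nest has the same components along
exponential vectors as a multiple of an exponential vector. -/
theorem exists_exp_eq (hF : IsNest F) {τ : FullFock H} (hτ : FactorsAlong F τ)
    (h1 : ⟪fullExp (0 : H), τ⟫_ℂ = 1) :
    ∃ ξ : H, ∀ η, F 1 η = η → ⟪fullExp η, τ⟫_ℂ = Complex.exp ⟪η, ξ⟫_ℂ := by
  -- The one-particle component of `τ` is the only candidate, since that of `e(ξ)` is `ξ`.
  set ξ : H := ContinuousLinearMap.adjoint (oneParticle H) τ with hξ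
  refine ⟨ξ, fun η hη => ?_⟩
  have hξ' : ∀ ζ, ⟪oneParticle H ζ, τ⟫_ℂ = ⟪ζ, ξ⟫_ℂ := fun ζ => by
    rw [hξ, ContinuousLinearMap.adjoint_inner_right]
  set X : ℂ := ⟪fullExp η, τ⟫_ℂ * Complex.exp (-⟪η, ξ⟫_ℂ) with hX
  -- Here `δ` bounds the increments of `η`; its range ensures both `δ ≤ 1` and `‖⟪D k, ξ⟫‖ ≤ 1`, as
  -- the two remainder estimates require.
  have bound : ∀ δ ∈ Set.Ioo (0 : ℝ) (1 / (1 + ‖ξ‖)),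
      ‖X - 1‖ ≤ Real.exp (3 * (δ ^ 2 * ‖ξ‖ ^ 2) + 3 * (δ * ‖η‖ * ‖τ‖)) - 1 := by
    intro δ hδ
    have hδ0 := hδ.1
    have hδ1 : δ * (1 + ‖ξ‖) < 1 := (lt_div_iff₀ (by positivity)).1 hδ.2
    have hδ2 : δ ≤ 1 := by nlinarith [norm_nonneg ξ]
    obtain ⟨n, hn, hsmall⟩ := hF.exists_nestIncr_le η hδ0
    set D : ℕ → H := fun k => nestIncr F n k η with hD
    have hr : ∀ k, ⟪fullExp (D k), τ⟫_ℂ = 1 + ⟪D k, ξ⟫_ℂ + ⟪expRemainder (D k), τ⟫_ℂ := by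
      intro k
      rw [expRemainder, inner_sub_left, inner_sub_left, h1, hξ']; ring
    have hsum : ∑ k ∈ Finset.range n, ⟪D k, ξ⟫_ℂ = ⟪η, ξ⟫_ℂ := by
      rw [← sum_inner, hF.sum_nestIncr hn, hη]
    -- The exponential is distributed over the subintervals, so that `X` becomes a product of
    -- factors close to `1`.
    have hprod : X = ∏ k ∈ Finset.range n, (1 + (⟪fullExp (D k), τ⟫_ℂ *
        Complex.exp (-⟪D k, ξ⟫_ℂ) - 1)) := by
      simp only [add_sub_cancel]
      rw [Finset.prod_mul_distrib, hF.prod_nestIncr hτ h1 hn, hη, ← Complex.exp_sum,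
        Finset.sum_neg_distrib, hsum]
    have ha : ∀ k ∈ Finset.range n, ‖⟪D k, ξ⟫_ℂ‖ ≤ δ * ‖nestIncr F n k ξ‖ := by
      intro k hk
      rw [hD, hF.inner_nestIncr_left]
      exact (norm_inner_le_norm _ _).trans
        (mul_le_mul_of_nonneg_right (hsmall k (Finset.mem_range.1 hk)) (norm_nonneg _))
    have ha1 : ∀ k ∈ Finset.range n, ‖⟪D k, ξ⟫_ℂ‖ ≤ 1 := by
      intro k hk
      have := (norm_inner_le_norm (𝕜 := ℂ) (D k) ξ).trans
        (mul_le_mul_of_nonneg_right (hsmall k (Finset.mem_range.1 hk)) (norm_nonneg ξ))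
      nlinarith
    have hsa : ∑ k ∈ Finset.range n, ‖⟪D k, ξ⟫_ℂ‖ ^ 2 ≤ δ ^ 2 * ‖ξ‖ ^ 2 := by
      refine (Finset.sum_le_sum fun k hk => pow_le_pow_left₀ (norm_nonneg _) (ha k hk) 2).trans ?_
      simp_rw [mul_pow]
      rw [← Finset.mul_sum]
      exact mul_le_mul_of_nonneg_left (hF.sum_norm_nestIncr_sq_le hn ξ) (sq_nonneg _)
    -- Cauchy–Schwarz in each term would only give the bound `‖η‖ ^ 2 * ‖τ‖`, which is not small.
    -- Orthogonality of the remainders gains the factor `δ`.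
    have hsr : ∑ k ∈ Finset.range n, ‖⟪expRemainder (D k), τ⟫_ℂ‖ ≤ δ * ‖η‖ * ‖τ‖ := by
      refine (sum_norm_inner_le _ _ _ ?_).trans ?_
      · intro i _ j _ hij
        rw [inner_expRemainder, hF.inner_nestIncr hij]; simp
      · refine mul_le_mul_of_nonneg_right ?_ (norm_nonneg _)
        refine Real.sqrt_le_iff.2 ⟨by positivity, ?_⟩
        calc ∑ k ∈ Finset.range n, ‖expRemainder (D k)‖ ^ 2
            ≤ ∑ k ∈ Finset.range n, δ ^ 2 * ‖D k‖ ^ 2 := by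
              refine Finset.sum_le_sum fun k hk => ?_
              have h2 := hsmall k (Finset.mem_range.1 hk)
              refine (norm_expRemainder_sq_le _ (h2.trans hδ2)).trans ?_
              rw [sq]
              exact mul_le_mul_of_nonneg_right (pow_le_pow_left₀ (norm_nonneg _) h2 2)
                (sq_nonneg _)
          _ ≤ (δ * ‖η‖) ^ 2 := by
              rw [← Finset.mul_sum, mul_pow]
              exact mul_le_mul_of_nonneg_left (hF.sum_norm_nestIncr_sq_le hn η) (sq_nonneg _)
    rw [hprod]
    refine (Finset.norm_prod_one_add_sub_one_le _ _).trans ?_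
    gcongr
    calc ∑ k ∈ Finset.range n, ‖⟪fullExp (D k), τ⟫_ℂ * Complex.exp (-⟪D k, ξ⟫_ℂ) - 1‖
        ≤ ∑ k ∈ Finset.range n, (3 * ‖⟪D k, ξ⟫_ℂ‖ ^ 2 + 3 * ‖⟪expRemainder (D k), τ⟫_ℂ‖) := by
          refine Finset.sum_le_sum fun k hk => ?_
          rw [hr]
          exact norm_one_add_mul_exp_sub_le (ha1 k hk)
      _ ≤ _ := by
          rw [Finset.sum_add_distrib, ← Finset.mul_sum, ← Finset.mul_sum]
          gcongr
  have hlim : Filter.Tendsto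
      (fun δ : ℝ => Real.exp (3 * (δ ^ 2 * ‖ξ‖ ^ 2) + 3 * (δ * ‖η‖ * ‖τ‖)) - 1)
      (nhdsWithin 0 (Set.Ioi 0)) (nhds 0) := by
    have h2 : Continuous
        fun δ : ℝ => Real.exp (3 * (δ ^ 2 * ‖ξ‖ ^ 2) + 3 * (δ * ‖η‖ * ‖τ‖)) - 1 := by fun_prop
    have := h2.tendsto 0
    simp only [ne_eq, OfNat.ofNat_ne_zero, not_false_eq_true, zero_pow, zero_mul, mul_zero,
      add_zero, Real.exp_zero, sub_self] at this
    exact this.mono_left nhdsWithin_le_nhds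
  -- `X` does not depend on the subdivision, so `δ` may tend to `0`.
  have hle : ‖X - 1‖ ≤ 0 := by
    refine ge_of_tendsto hlim ?_
    filter_upwards [Ioo_mem_nhdsGT (show (0 : ℝ) < 1 / (1 + ‖ξ‖) by positivity)] with δ hδ
    exact bound δ hδ
  have hX1 : X = 1 := sub_eq_zero.1 (norm_le_zero_iff.1 hle)
  rw [hX, Complex.exp_neg, mul_inv_eq_one₀ (Complex.exp_ne_zero _)] at hX1
  exact hX1

end IsNest

end Nest

theorem eq_of_inner_eq_of_dense {X E : Type*} [NormedAddCommGroup E] [InnerProductSpace ℂ E]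
    {f : X → E} (hf : Dense (Submodule.span ℂ (Set.range f) : Set E)) {a b : E}
    (h : ∀ x, ⟪f x, a⟫_ℂ = ⟪f x, b⟫_ℂ) : a = b := by
  refine hf.eq_of_inner_right ℂ fun x hx => ?_
  induction hx using Submodule.span_induction with
  | zero => simp
  | add x y _ _ hx hy => rw [inner_add_left, inner_add_left, hx, hy]
  | smul c x _ hx => rw [inner_smul_left, inner_smul_left, hx]
  | mem x hx => obtain ⟨i, rfl⟩ := hx; exact h i

/-- Commutation with rank one operators suffices: applied to `b`, it gives `⟪b, b⟫ • Z a = ⟪b, Z b⟫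
• a`. -/
theorem exists_eq_smul_one_of_commute {𝓗 : Type*} [NormedAddCommGroup 𝓗]
    [InnerProductSpace ℂ 𝓗] (Z : 𝓗 →L[ℂ] 𝓗) (h : ∀ A, Z * A = A * Z) :
    ∃ c : ℂ, Z = c • 1 := by
  by_cases h0 : ∃ b : 𝓗, b ≠ 0
  · obtain ⟨b, hb⟩ := h0
    have hb' : ⟪b, b⟫_ℂ ≠ 0 := inner_self_ne_zero.2 hb
    refine ⟨⟪b, Z b⟫_ℂ / ⟪b, b⟫_ℂ, ContinuousLinearMap.ext fun a => ?_⟩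
    have h1 := DFunLike.congr_fun (h (InnerProductSpace.rankOne ℂ a b)) b
    simp only [mul_apply_eq_comp, InnerProductSpace.rankOne_apply, map_smul] at h1
    simp only [smul_apply, one_apply_eq_self]
    rw [div_eq_inv_mul, mul_smul, ← h1, inv_smul_smul₀ hb']
  · push Not at h0
    exact ⟨0, ContinuousLinearMap.ext fun a => by rw [h0 a]; simp⟩

/-! ### Fibres of the product system -/

section Fiber
variable {E : Type*} [NormedAddCommGroup E] [NormedSpace ℝ E] {P : PointedCone ℝ E}
  {𝓗 : Type u} [NormedAddCommGroup 𝓗] [InnerProductSpace ℂ 𝓗] [CompleteSpace 𝓗]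

variable {α : EndFamily P 𝓗} {x : P} {S T : 𝓗 →L[ℂ] 𝓗}

/-- `S` intertwines `A` with `α x A` and `star T` intertwines them in the other direction, so `star
T * S` commutes with every operator. -/
theorem star_mul_eq_fiberInner_smul (hS : S ∈ fiber α x) (hT : T ∈ fiber α x) :
    star T * S = fiberInner S T • 1 := by
  have h : ∃ c : ℂ, star T * S = c • 1 := by
    refine exists_eq_smul_one_of_commute _ fun A => ?_
    have h1 : A * star T = star T * α x A := by
      have := congrArg star (hT (star A))
      simpa [map_star] using this.symm
    rw [mul_assoc, ← hS A, ← mul_assoc, ← h1, mul_assoc]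
  rw [fiberInner, dif_pos h]
  exact h.choose_spec

theorem fiberInner_eq_of_star_mul [Nontrivial 𝓗] {c : ℂ} (h : star T * S = c • 1) :
    fiberInner S T = c := by
  have h' : ∃ c : ℂ, star T * S = c • 1 := ⟨c, h⟩
  rw [fiberInner, dif_pos h']
  have h1 : h'.choose • (1 : 𝓗 →L[ℂ] 𝓗) = c • 1 := h'.choose_spec.symm.trans h
  exact smul_left_injective ℂ one_ne_zero h1

theorem inner_apply_apply (hS : S ∈ fiber α x) (hT : T ∈ fiber α x) (a b : 𝓗) :
    ⟪T a, S b⟫_ℂ = fiberInner S T * ⟪a, b⟫_ℂ := by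
  rw [← ContinuousLinearMap.adjoint_inner_right, ← ContinuousLinearMap.star_eq_adjoint,
    ← mul_apply_eq_comp, star_mul_eq_fiberInner_smul hS hT]
  simp [inner_smul_right]

/-- A fibre element is a multiple of an isometry, so its norm can be read off at any unit vector,
later the vacuum. -/
theorem norm_apply_of_mem_fiber (hT : T ∈ fiber α x) {a : 𝓗} (ha : ‖a‖ = 1) (b : 𝓗) :
    ‖T b‖ = ‖T a‖ * ‖b‖ := by
  have h : ∀ b : 𝓗, ‖T b‖ ^ 2 = ‖fiberInner T T‖ * ‖b‖ ^ 2 := by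
    intro b
    have h1 := congrArg norm (inner_apply_apply hT hT b b)
    rw [norm_mul, inner_self_eq_norm_sq_to_K, inner_self_eq_norm_sq_to_K] at h1
    simpa using h1
  refine (pow_left_inj₀ (norm_nonneg _) (by positivity) two_ne_zero).1 ?_
  rw [mul_pow, h, h a, ha]; ring

theorem norm_eq_of_mem_fiber (hT : T ∈ fiber α x) {a : 𝓗} (ha : ‖a‖ = 1) : ‖T‖ = ‖T a‖ := by
  refine le_antisymm (T.opNorm_le_bound (norm_nonneg _) fun b =>
    (norm_apply_of_mem_fiber hT ha b).le) ?_
  simpa [ha] using T.le_opNorm a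

theorem isClosed_fiber : IsClosed (fiber α x : Set (𝓗 →L[ℂ] 𝓗)) := by
  have h : (fiber α x : Set (𝓗 →L[ℂ] 𝓗)) = ⋂ A, {T | α x A * T = T * A} := by
    ext T; simp [fiber]
  rw [h]
  exact isClosed_iInter fun A => isClosed_eq (by fun_prop) (by fun_prop)

theorem IsDecomposableVector.smul {u : 𝓗 →L[ℂ] 𝓗} (hu : IsDecomposableVector α x u) {c : ℂ}
    (hc : c ≠ 0) : IsDecomposableVector α x (c • u) := by
  refine ⟨(fiber α x).smul_mem c hu.1, smul_ne_zero hc hu.2.1, fun y z h => ?_⟩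
  obtain ⟨v, hv, w, hw, rfl⟩ := hu.2.2 y z h
  exact ⟨c • v, (fiber α y).smul_mem c hv, w, hw, (smul_mul_assoc c v w).symm⟩

end Fiber

/-! ### Rays and interior points of the cone -/

section Cone
variable {E : Type*} [NormedAddCommGroup E] [NormedSpace ℝ E] {P : PointedCone ℝ E}

/-- The point `max t 0 • x` of the ray through `x`. -/
def ray (x : P) (t : ℝ) : P :=
  ⟨max t 0 • (x : E), P.smul_mem (le_max_right _ _) x.2⟩

theorem ray_zero (x : P) : ray x 0 = 0 := by ext; simp [ray]

theorem ray_one (x : P) : ray x 1 = x := by ext; simp [ray]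

theorem continuous_ray (x : P) : Continuous (ray x) := by
  unfold ray
  exact Continuous.subtype_mk (by fun_prop) _

theorem ray_add (x : P) {s t : ℝ} (h : s ≤ t) : ∃ z, ray x s + z = ray x t := by
  refine ⟨⟨(max t 0 - max s 0) • (x : E), P.smul_mem
    (sub_nonneg.2 (max_le_max_right 0 h)) x.2⟩, ?_⟩
  ext
  simp [ray, ← add_smul]

open scoped Pointwise in
theorem ray_mem_interior (a : ConeInterior P) {t : ℝ} (ht : 0 < t) :
    (ray a.1 t : E) ∈ interior (P : Set E) := by
  have h1 : t • (P : Set E) ⊆ P := by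
    rintro _ ⟨y, hy, rfl⟩
    exact P.smul_mem ht.le hy
  have h2 : t • interior (P : Set E) ⊆ interior (P : Set E) := by
    rw [← interior_smul₀ ht.ne']
    exact interior_mono h1
  have h3 : (ray a.1 t : E) = t • (a.1 : E) := by simp [ray, max_eq_left ht.le]
  rw [h3]
  exact h2 (Set.smul_mem_smul_set a.2)

theorem add_mem_interior (x : P) (a : ConeInterior P) :
    ((x + a.1 : P) : E) ∈ interior (P : Set E) := by
  have h : (fun y : E => (x : E) + y) '' interior (P : Set E) ⊆ interior (P : Set E) := by
    refine interior_maximal ?_ (isOpenMap_add_left (x : E) _ isOpen_interior)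
    rintro _ ⟨y, hy, rfl⟩
    exact P.add_mem x.2 (interior_subset hy)
  exact h ⟨_, a.2, rfl⟩

theorem exists_coneInterior_mem (a : ConeInterior P) {U : Set P} (hU : U ∈ nhds (0 : P)) :
    ∃ c : ConeInterior P, c.1 ∈ U := by
  have h1 : Filter.Tendsto (ray a.1) (nhdsWithin 0 (Set.Ioi 0)) (nhds 0) := by
    have := (continuous_ray a.1).tendsto 0
    rw [ray_zero] at this
    exact this.mono_left nhdsWithin_le_nhds
  obtain ⟨t, ht, ht0⟩ := ((h1.eventually hU).and self_mem_nhdsWithin).exists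
  exact ⟨⟨ray a.1 t, ray_mem_interior a ht0⟩, ht⟩

end Cone

/-! ### Adjoints and range projections of an isometric representation -/

namespace IsometricRep
variable {E : Type*} [NormedAddCommGroup E] [NormedSpace ℝ E] {P : PointedCone ℝ E}
  {H : Type u} [NormedAddCommGroup H] [InnerProductSpace ℂ H] [CompleteSpace H]
  (V : IsometricRep P H)

/-- The adjoint of `Vₓ`. -/
def adj (x : P) : H →L[ℂ] H := ContinuousLinearMap.adjoint (V.toFun x).toContinuousLinearMap

theorem inner_adj_left (x : P) (ξ η : H) : ⟪V.adj x ξ, η⟫_ℂ = ⟪ξ, V.toFun x η⟫_ℂ :=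
  ContinuousLinearMap.adjoint_inner_left _ _ _

theorem inner_adj_right (x : P) (ξ η : H) : ⟪ξ, V.adj x η⟫_ℂ = ⟪V.toFun x ξ, η⟫_ℂ :=
  ContinuousLinearMap.adjoint_inner_right _ _ _

@[simp] theorem adj_apply_self (x : P) (ξ : H) : V.adj x (V.toFun x ξ) = ξ := by
  refine ext_inner_right ℂ fun η => ?_
  rw [inner_adj_left, LinearIsometry.inner_map_map]

theorem adj_add (x y : P) (ξ : H) : V.adj (x + y) ξ = V.adj y (V.adj x ξ) := by
  refine ext_inner_right ℂ fun η => ?_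
  rw [inner_adj_left, V.map_add, inner_adj_left, inner_adj_left]

theorem norm_adj_le (x : P) (ξ : H) : ‖V.adj x ξ‖ ≤ ‖ξ‖ := by
  have h1 := norm_inner_le_norm (𝕜 := ℂ) ξ (V.toFun x (V.adj x ξ))
  rw [← inner_adj_left, inner_self_eq_norm_sq_to_K, LinearIsometry.norm_map] at h1
  have h2 : ‖V.adj x ξ‖ ^ 2 ≤ ‖ξ‖ * ‖V.adj x ξ‖ := by simpa using h1
  by_cases h : ‖V.adj x ξ‖ = 0
  · rw [h]; positivity
  · have : 0 < ‖V.adj x ξ‖ := lt_of_le_of_ne (norm_nonneg _) (Ne.symm h)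
    nlinarith

theorem norm_adj_sub_le (x : P) (ξ : H) : ‖V.adj x ξ - ξ‖ ≤ ‖V.toFun x ξ - ξ‖ := by
  have h : V.adj x ξ - ξ = -V.adj x (V.toFun x ξ - ξ) := by simp
  rw [h, norm_neg]
  exact V.norm_adj_le x _

theorem mem_orthogonal_range_iff (x : P) (ξ : H) :
    ξ ∈ (LinearMap.range (V.toFun x).toLinearMap)ᗮ ↔ V.adj x ξ = 0 := by
  rw [Submodule.mem_orthogonal]
  constructor
  · intro h
    refine ext_inner_left ℂ fun η => ?_
    rw [inner_adj_right, inner_zero_right]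
    exact h _ (LinearMap.mem_range_self _ η)
  · rintro h _ ⟨η, rfl⟩
    refine (V.inner_adj_right x η ξ).symm.trans ?_
    rw [h, inner_zero_right]

/-- The orthogonal projection `1 - Vₓ Vₓ*` onto `ker Vₓ*`. -/
def coproj (x : P) : H →L[ℂ] H := 1 - (V.toFun x).toContinuousLinearMap * V.adj x

theorem coproj_apply (x : P) (ξ : H) : V.coproj x ξ = ξ - V.toFun x (V.adj x ξ) := rfl

@[simp] theorem adj_coproj (x : P) (ξ : H) : V.adj x (V.coproj x ξ) = 0 := by
  simp [coproj_apply]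

theorem coproj_eq_self_iff {x : P} {ξ : H} : V.coproj x ξ = ξ ↔ V.adj x ξ = 0 :=
  ⟨fun h => by rw [← h, adj_coproj], fun h => by rw [coproj_apply, h, _root_.map_zero, sub_zero]⟩

theorem coproj_self {x : P} {ξ : H} (h : V.adj x ξ = 0) : V.coproj x ξ = ξ :=
  V.coproj_eq_self_iff.2 h

theorem adj_add_eq_zero {x : P} {ξ : H} (h : V.adj x ξ = 0) (y : P) : V.adj (x + y) ξ = 0 := by
  rw [adj_add, h, _root_.map_zero]

@[simp] theorem coproj_coproj_add (x y : P) (ξ : H) :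
    V.coproj x (V.coproj (x + y) ξ) = V.coproj x ξ := by
  rw [coproj_apply V (x + y), map_sub, sub_eq_self, V.map_add, coproj_apply, adj_apply_self,
    sub_self]

@[simp] theorem coproj_add_coproj (x y : P) (ξ : H) :
    V.coproj (x + y) (V.coproj x ξ) = V.coproj x ξ :=
  V.coproj_self (V.adj_add_eq_zero (V.adj_coproj x ξ) y)

@[simp] theorem coproj_coproj (x : P) (ξ : H) : V.coproj x (V.coproj x ξ) = V.coproj x ξ :=
  V.coproj_self (V.adj_coproj x ξ)

theorem adj_zero (ξ : H) : V.adj 0 ξ = ξ := by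
  have := V.adj_apply_self 0 ξ
  rwa [V.map_zero] at this

theorem coproj_zero (ξ : H) : V.coproj 0 ξ = 0 := by
  rw [coproj_apply, V.map_zero, adj_zero, sub_self]

theorem inner_coproj (x : P) (ξ η : H) : ⟪V.coproj x ξ, η⟫_ℂ = ⟪ξ, V.coproj x η⟫_ℂ := by
  rw [coproj_apply, coproj_apply, inner_sub_left, inner_sub_right, ← inner_adj_right,
    ← inner_adj_left]

theorem coproj_add_toFun_adj (x : P) (ξ : H) :
    V.coproj x ξ + V.toFun x (V.adj x ξ) = ξ := by
  rw [coproj_apply, sub_add_cancel]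

/-- Strong continuity of adjoints is not automatic. Choose a small interior point `c`. For `x'` near
`x` one has `c + x' = x + y` with `y` near `c`, hence still in the cone, and the adjoint at `x'` of
`ξ` equals the adjoint at `x + y` of `V_c ξ`. Since adjoints are contractions, the error is
controlled by how far `V_c` moves `ξ` and `V_y` moves `ζ`. -/
theorem continuous_adj (a : ConeInterior P) (ξ : H) : Continuous fun x => V.adj x ξ := by
  refine continuous_iff_continuousAt.2 fun x => Metric.tendsto_nhds.2 fun ε hε => ?_
  set ζ := V.adj x ξ with hζ
  have hnear : ∀ η : H, {y : P | ‖V.toFun y η - η‖ < ε / 2} ∈ nhds (0 : P) := by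
    intro η
    have h : Continuous fun y : P => ‖V.toFun y η - η‖ :=
      ((V.continuous η).sub continuous_const).norm
    exact h.continuousAt.eventually_lt_const (by simpa [V.map_zero] using hε)
  obtain ⟨c, hc1, hc2⟩ := exists_coneInterior_mem a (Filter.inter_mem (hnear ξ) (hnear ζ))
  simp only [Set.mem_ofPred_eq] at hc1 hc2
  have hopen : IsOpen {y : P | ‖V.toFun y ζ - ζ‖ < ε / 2} :=
    isOpen_lt ((V.continuous ζ).sub continuous_const).norm continuous_const
  obtain ⟨O, hO, hO'⟩ := isOpen_induced_iff.1 hopen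
  have hcO : (c.1 : E) ∈ O := by
    have : c.1 ∈ Subtype.val ⁻¹' O := by rw [hO']; exact hc2
    exact this
  have hcont : Continuous fun x' : P => (x' : E) + c.1 - x := by fun_prop
  have hmem : O ∩ interior (P : Set E) ∈ nhds ((x : E) + c.1 - x) := by
    rw [add_sub_cancel_left]
    exact (hO.inter isOpen_interior).mem_nhds ⟨hcO, c.2⟩
  filter_upwards [hcont.continuousAt.eventually_mem hmem] with x' hx'
  set y : P := ⟨(x' : E) + c.1 - x, interior_subset hx'.2⟩ with hy
  have hy1 : ‖V.toFun y ζ - ζ‖ < ε / 2 := by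
    have : y ∈ Subtype.val ⁻¹' O := hx'.1
    rw [hO'] at this
    exact this
  have hadd : c.1 + x' = x + y := by ext; simp [hy, add_comm]
  have h1 : V.adj x' ξ = V.adj y (V.adj x (V.toFun c.1 ξ)) := by
    rw [← adj_add, ← hadd, adj_add, adj_apply_self]
  have h2 : V.adj x' ξ - ζ = V.adj y (V.adj x (V.toFun c.1 ξ - ξ)) + (V.adj y ζ - ζ) := by
    rw [h1, map_sub, map_sub, hζ]; abel
  rw [dist_eq_norm, h2]
  calc _ ≤ ‖V.toFun c.1 ξ - ξ‖ + ‖V.toFun y ζ - ζ‖ :=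
        (norm_add_le _ _).trans (add_le_add
          ((V.norm_adj_le _ _).trans (V.norm_adj_le _ _)) (V.norm_adj_sub_le _ _))
    _ < ε := by linarith

theorem continuous_coproj (a : ConeInterior P) (ξ : H) : Continuous fun x => V.coproj x ξ := by
  simp_rw [coproj_apply]
  refine continuous_const.sub (continuous_iff_continuousAt.2 fun x => ?_)
  rw [ContinuousAt, tendsto_iff_norm_sub_tendsto_zero]
  have h1 : ∀ y, ‖V.toFun y (V.adj y ξ) - V.toFun x (V.adj x ξ)‖ ≤
      ‖V.adj y ξ - V.adj x ξ‖ + ‖V.toFun y (V.adj x ξ) - V.toFun x (V.adj x ξ)‖ := by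
    intro y
    rw [← (V.toFun y).norm_map (V.adj y ξ - V.adj x ξ), map_sub]
    exact norm_sub_le_norm_sub_add_norm_sub _ _ _
  refine squeeze_zero (fun _ => norm_nonneg _) h1 ?_
  have h2 : Continuous fun y => ‖V.adj y ξ - V.adj x ξ‖ +
      ‖V.toFun y (V.adj x ξ) - V.toFun x (V.adj x ξ)‖ :=
    (((V.continuous_adj a ξ).sub continuous_const).norm).add
      (((V.continuous _).sub continuous_const).norm)
  simpa using h2.tendsto x

/-- Points of a ray are comparable in the order of the cone, and `ker Vₓ*` grows with `x`. -/
theorem isNest_coproj (a : ConeInterior P) (x : P) : IsNest fun t => V.coproj (ray x t) where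
  comp s t η := by
    rcases le_total s t with h | h
    · obtain ⟨z, hz⟩ := ray_add x h
      rw [min_eq_left h, ← hz, coproj_coproj_add]
    · obtain ⟨z, hz⟩ := ray_add x h
      rw [min_eq_right h, ← hz, coproj_add_coproj]
  symm t := V.inner_coproj _
  zero η := by simp only [ray_zero, coproj_zero]
  continuous η := (V.continuous_coproj a η).comp (continuous_ray x)

end IsometricRep

/-! ### Nontriviality of Fock space and separation of exponents -/

section Fock
variable {H : Type u} [NormedAddCommGroup H] [InnerProductSpace ℂ H]

theorem norm_expVec_zero : ‖expVec (0 : H)‖ = 1 := by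
  have h := inner_expVec (0 : H) 0
  rw [inner_self_eq_norm_sq_to_K, inner_zero_left, Complex.exp_zero] at h
  have h1 : ‖expVec (0 : H)‖ ^ 2 = 1 := Complex.ofReal_injective (by simpa using h)
  exact (pow_eq_one_iff_of_nonneg (norm_nonneg _) two_ne_zero).1 h1

instance : Nontrivial (Fock H) :=
  ⟨expVec 0, 0, fun h => by simpa [h] using norm_expVec_zero (H := H)⟩

/-- `θ = 0` gives the constant; `θ = ξ - η` then gives `exp (‖ξ - η‖ ^ 2) = 1`. -/
theorem eq_of_exp_inner_eq {ξ η : H} {c : ℂ}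
    (h : ∀ θ, Complex.exp ⟪θ, ξ⟫_ℂ = c * Complex.exp ⟪θ, η⟫_ℂ) : c = 1 ∧ ξ = η := by
  have hc : c = 1 := by simpa using (h 0).symm
  refine ⟨hc, ?_⟩
  subst hc
  simp_rw [one_mul] at h
  have h1 := h (ξ - η)
  have h2 : Complex.exp ⟪ξ - η, ξ - η⟫_ℂ = 1 := by
    rw [inner_sub_right, Complex.exp_sub, h1, div_self (Complex.exp_ne_zero _)]
  rw [inner_self_eq_norm_sq_to_K] at h2
  have h3 : Real.exp (‖ξ - η‖ ^ 2) = 1 := by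
    have : ((Real.exp (‖ξ - η‖ ^ 2) : ℝ) : ℂ) = 1 := by rw [← h2]; simp
    exact_mod_cast this
  rw [Real.exp_eq_one_iff] at h3
  exact sub_eq_zero.1 (norm_eq_zero.1 (pow_eq_zero_iff two_ne_zero |>.1 h3))

theorem exists_toFull (τ : Fock H) : ∃ τ' : FullFock H, ∀ η, ⟪expVec η, τ⟫_ℂ = ⟪fullExp η, τ'⟫_ℂ :=
  ⟨Subtype.val (p := (· ∈ fockSubmodule H)) τ, fun _ => rfl⟩

end Fock

/-! ### The product system of a CCR flow and its decomposable vectors -/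

namespace IsometricRep
variable {E : Type*} [NormedAddCommGroup E] [NormedSpace ℝ E] {P : PointedCone ℝ E}
  {H : Type u} [NormedAddCommGroup H] [InnerProductSpace ℂ H] [CompleteSpace H]
  (V : IsometricRep P H)

/-- The operator `e(η) ↦ e(ξ' + Vₓ η)`, where `ξ'` is the projection of `ξ` to `ker Vₓ*`. -/
def shift (x : P) (ξ : H) : Fock H →L[ℂ] Fock H :=
  fockShift (V.toFun x) ⟨V.coproj x ξ, (V.mem_orthogonal_range_iff x _).2 (V.adj_coproj x ξ)⟩

theorem shift_expVec (x : P) (ξ η : H) :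
    V.shift x ξ (expVec η) = expVec (V.coproj x ξ + V.toFun x η) :=
  fockShift_expVec _ _ _

theorem shift_mem_fiber (x : P) (ξ : H) : V.shift x ξ ∈ fiber (ccrFlow V) x :=
  fun A => ccrEnd_mul_fockShift _ A _

theorem fiberInner_shift (x : P) (ξ η : H) :
    fiberInner (V.shift x ξ) (V.shift x η) = Complex.exp ⟪V.coproj x η, V.coproj x ξ⟫_ℂ :=
  fiberInner_eq_of_star_mul (adjoint_fockShift_mul _ _ _)

theorem shift_ne_zero (x : P) (ξ : H) : V.shift x ξ ≠ 0 := by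
  intro h
  have h1 := V.fiberInner_shift x ξ ξ
  rw [fiberInner_eq_of_star_mul (c := 0) (by rw [h]; simp)] at h1
  exact Complex.exp_ne_zero _ h1.symm

/-- Multiplication of exponential fibre elements adds their exponents, the second being translated
by `Vₓ`. This additive law is the source of the logarithmic coordinates. -/
theorem shift_mul_shift (x y : P) (ξ η : H) :
    V.shift x ξ * V.shift y η = V.shift (x + y) (V.coproj x ξ + V.toFun x (V.coproj y η)) := by
  refine clm_ext_of_dense dense_span_expVec fun ζ => ?_
  rw [mul_apply_eq_comp, shift_expVec, shift_expVec, shift_expVec, _root_.map_add, V.map_add,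
    _root_.map_add (V.coproj _), coproj_add_coproj, V.coproj_self (ξ := V.toFun x (V.coproj y η)),
    add_assoc]
  rw [adj_add, adj_apply_self, adj_coproj]

theorem shift_coproj (x : P) (ξ : H) : V.shift x (V.coproj x ξ) = V.shift x ξ :=
  clm_ext_of_dense dense_span_expVec fun ζ => by
    rw [shift_expVec, shift_expVec, coproj_coproj]

theorem shift_add (x y : P) (ξ : H) :
    V.shift (x + y) ξ = V.shift x ξ * V.shift y (V.adj x ξ) := by
  rw [shift_mul_shift, ← shift_coproj]
  congr 1
  rw [coproj_apply, coproj_apply, coproj_apply, V.map_add, adj_add, map_sub]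
  abel

theorem isDecomposableVector_shift (x : P) (ξ : H) :
    IsDecomposableVector (ccrFlow V) x (V.shift x ξ) := by
  refine ⟨V.shift_mem_fiber x ξ, V.shift_ne_zero x ξ, ?_⟩
  rintro y z rfl
  exact ⟨_, V.shift_mem_fiber y ξ, _, V.shift_mem_fiber z _, V.shift_add y z ξ⟩

theorem inner_shift_apply {x : P} {T : Fock H →L[ℂ] Fock H} (hT : T ∈ fiber (ccrFlow V) x)
    (ξ : H) (a b : Fock H) :
    ⟪V.shift x ξ a, T b⟫_ℂ = ⟪expVec (V.coproj x ξ), T (expVec 0)⟫_ℂ * ⟪a, b⟫_ℂ := by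
  have h := inner_apply_apply hT (V.shift_mem_fiber x ξ) (expVec 0) (expVec 0)
  rw [shift_expVec, _root_.map_zero, add_zero, inner_expVec, inner_zero_left, Complex.exp_zero,
    mul_one] at h
  rw [inner_apply_apply hT (V.shift_mem_fiber x ξ), h]

/-- Every `e(η)` is the image of an exponential vector under the shift by `η`, so the matrix
elements of a fibre element reduce to those of its value at the vacuum. -/
theorem eq_of_inner_expVec {x : P} {S T : Fock H →L[ℂ] Fock H} (hS : S ∈ fiber (ccrFlow V) x)
    (hT : T ∈ fiber (ccrFlow V) x)
    (h : ∀ ξ, ⟪expVec (V.coproj x ξ), S (expVec 0)⟫_ℂ = ⟪expVec (V.coproj x ξ), T (expVec 0)⟫_ℂ) :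
    S = T := by
  refine ContinuousLinearMap.ext fun b => ?_
  refine eq_of_inner_eq_of_dense dense_span_expVec fun η => ?_
  have hη : V.shift x η (expVec (V.adj x η)) = expVec η := by
    rw [shift_expVec, coproj_add_toFun_adj]
  rw [← hη, V.inner_shift_apply hS, V.inner_shift_apply hT, h]

theorem inner_expVec_mul {y : P} {S R : Fock H →L[ℂ] Fock H} (hS : S ∈ fiber (ccrFlow V) y)
    (ξ η : H) : ⟪expVec (V.coproj y ξ + V.toFun y η), (S * R) (expVec 0)⟫_ℂ =
      ⟪expVec (V.coproj y ξ), S (expVec 0)⟫_ℂ * ⟪expVec η, R (expVec 0)⟫_ℂ := by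
  rw [← shift_expVec, mul_apply_eq_comp, V.inner_shift_apply hS]

/-- Araki–Woods: the decomposable vectors are the multiples of exponential vectors. -/
theorem exists_eq_smul_shift (a : ConeInterior P) {x : P} {u : Fock H →L[ℂ] Fock H}
    (hu : IsDecomposableVector (ccrFlow V) x u) :
    ∃ c : ℂ, c ≠ 0 ∧ ∃ ξ, V.adj x ξ = 0 ∧ u = c • V.shift x ξ := by
  obtain ⟨hu1, hu2, hu3⟩ := hu
  have hnest := V.isNest_coproj a x
  obtain ⟨τ, hτ⟩ := exists_toFull (u (expVec 0))
  -- Writing `u = S * R` along `t x + z = x`, each amplitude is a function of the part in `ker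
  -- V_{tx}*` times a function of the rest. Exchanging the rests of `η` and `ζ` only permutes the
  -- four factors.
  have hfac : FactorsAlong (fun t => V.coproj (ray x t)) τ := by
    intro t ht η ζ _ _
    obtain ⟨z, hz⟩ := ray_add x ht.2
    rw [ray_one] at hz
    obtain ⟨S, hS, R, hR, rfl⟩ := hu3 _ z hz
    have h1 : ∀ η ζ : H, ⟪fullExp (V.coproj (ray x t) η + (ζ - V.coproj (ray x t) ζ)), τ⟫_ℂ =
        ⟪expVec (V.coproj (ray x t) η), S (expVec 0)⟫_ℂ *
          ⟪expVec (V.adj (ray x t) ζ), R (expVec 0)⟫_ℂ := by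
      intro η ζ
      rw [← hτ, coproj_apply V _ ζ, sub_sub_cancel, V.inner_expVec_mul hS]
    have h2 : ∀ η : H, ⟪fullExp η, τ⟫_ℂ =
        ⟪expVec (V.coproj (ray x t) η), S (expVec 0)⟫_ℂ *
          ⟪expVec (V.adj (ray x t) η), R (expVec 0)⟫_ℂ := by
      intro η
      rw [← h1, add_sub_cancel]
    simp only [h1, h2]
    ring
  set c : ℂ := ⟪fullExp (0 : H), τ⟫_ℂ with hc
  -- If the vacuum amplitude vanished, then by `vacuum_ne_zero` so would all amplitudes, and `u`
  -- would be `0`.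
  have hc0 : c ≠ 0 := by
    intro h0
    refine hu2 (V.eq_of_inner_expVec hu1 (Submodule.zero_mem _) fun ξ => ?_)
    rw [zero_apply, inner_zero_right, hτ]
    by_contra h
    refine hnest.vacuum_ne_zero hfac (η := V.coproj x ξ) ?_ h h0
    simp [ray_one]
  have hfac' : FactorsAlong (fun t => V.coproj (ray x t)) (c⁻¹ • τ) := by
    intro t ht η ζ hη hζ
    have := hfac t ht η ζ hη hζ
    simp only [inner_smul_right]
    linear_combination c⁻¹ ^ 2 * this
  obtain ⟨ξ, hξ⟩ := hnest.exists_exp_eq hfac'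
    (by rw [inner_smul_right, ← hc, inv_mul_cancel₀ hc0])
  refine ⟨c, hc0, V.coproj x ξ, V.adj_coproj x ξ, ?_⟩
  refine V.eq_of_inner_expVec hu1 ((fiber _ x).smul_mem c (V.shift_mem_fiber x _)) fun η => ?_
  have h1 := hξ (V.coproj x η) (by simp [ray_one])
  rw [inner_smul_right, inv_mul_eq_iff_eq_mul₀ hc0] at h1
  rw [hτ, h1, smul_apply, shift_expVec, inner_smul_right, inner_expVec, _root_.map_zero, add_zero,
    coproj_coproj, ← V.inner_coproj, coproj_coproj]

theorem isDecomposable_ccrFlow (a : ConeInterior P) : IsDecomposable (ccrFlow V) := by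
  refine ⟨fun x y u v => ?_, fun x T hT => ?_⟩
  · obtain ⟨c, hc, ξ, hξ, hu⟩ := V.exists_eq_smul_shift a u.2
    obtain ⟨d, hd, η, hη, hv⟩ := V.exists_eq_smul_shift a v.2
    rw [hu, hv, smul_mul_smul_comm, shift_mul_shift]
    exact (V.isDecomposableVector_shift _ _).smul (mul_ne_zero hc hd)
  · set D := Submodule.span ℂ {u | IsDecomposableVector (ccrFlow V) x u} with hD
    have hDle : D ≤ fiber (ccrFlow V) x := Submodule.span_le.2 fun u hu => hu.1
    have hcl : (D.topologicalClosure : Set (Fock H →L[ℂ] Fock H)) ⊆ fiber (ccrFlow V) x :=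
      closure_minimal hDle isClosed_fiber
    let ev : (Fock H →L[ℂ] Fock H) →ₗ[ℂ] Fock H :=
      { toFun := fun T => T (expVec 0), map_add' := fun _ _ => rfl, map_smul' := fun _ _ => rfl }
    -- Evaluation at the vacuum is isometric on the fibre, so the closed span of the decomposable
    -- vectors has a closed image, onto which `T (expVec 0)` can be projected.
    let f : D.topologicalClosure →ₗᵢ[ℂ] Fock H :=
      { toLinearMap := ev ∘ₗ D.topologicalClosure.subtype
        norm_map' := fun S => (norm_eq_of_mem_fiber (hcl S.2) norm_expVec_zero).symm }
    have : CompleteSpace D.topologicalClosure :=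
      D.isClosed_topologicalClosure.completeSpace_coe
    have hcomp : IsComplete (LinearMap.range f.toLinearMap : Set (Fock H)) := by
      rw [LinearMap.coe_range]; exact f.isometry.isUniformInducing.isComplete_range
    have : CompleteSpace (LinearMap.range f.toLinearMap) := hcomp.completeSpace_coe
    obtain ⟨y, ⟨S, rfl⟩, w, hw, h⟩ :=
      (LinearMap.range f.toLinearMap).exists_add_mem_mem_orthogonal (T (expVec 0))
    have hST : T = S.1 := by
      refine V.eq_of_inner_expVec hT (hcl S.2) fun ξ => ?_
      -- The exponential vectors that determine a fibre element lie in the image of `f`, so the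
      -- orthogonal component `w` is invisible to them.
      have h0 : ⟪expVec (V.coproj x ξ), w⟫_ℂ = 0 := by
        refine hw _ ⟨⟨V.shift x ξ, D.le_topologicalClosure
          (Submodule.subset_span (V.isDecomposableVector_shift x ξ))⟩, ?_⟩
        refine (V.shift_expVec x ξ 0).trans ?_
        rw [_root_.map_zero, add_zero]
      rw [h, inner_add_right, h0, add_zero]
      rfl
    rw [hST]
    exact S.2

theorem exists_isUnitSection :
    ∃ e : ∀ x : P, DecVec (ccrFlow V) x, IsUnitSection e := by
  refine ⟨fun x => ⟨V.shift x 0, V.isDecomposableVector_shift x 0⟩, fun y z =>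
    ⟨⟨V.shift z 0, V.isDecomposableVector_shift z 0⟩, ?_⟩, fun x => ?_⟩
  · simp [shift_mul_shift]
  · simp [fiberInner_shift]

end IsometricRep

/-! ### Logarithmic coordinates, coherent sections and the `e`-logarithm -/

section LogCoord

variable {E : Type*} [NormedAddCommGroup E] [NormedSpace ℝ E] {P : PointedCone ℝ E}
  {𝓗 : Type u} [NormedAddCommGroup 𝓗] [InnerProductSpace ℂ 𝓗] [CompleteSpace 𝓗]
  {K : Type v} [NormedAddCommGroup K] [InnerProductSpace ℂ K] [CompleteSpace K]

/-- Logarithmic coordinates of the decomposable vectors of `α`: up to scalars they are the vectors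
of `ker Wₓ*`, products become cocycle sums, and inner products are exponentials. -/
structure LogCoord (α : EndFamily P 𝓗) (W : IsometricRep P K) where
  vec : ∀ {x : P}, DecVec α x → K
  adj_vec : ∀ {x : P} (u : DecVec α x), W.adj x (vec u) = 0
  exists_vec_eq : ∀ {x : P} {ξ : K}, W.adj x ξ = 0 → ∃ u : DecVec α x, vec u = ξ
  vec_eq_iff : ∀ {x : P} (u v : DecVec α x), vec u = vec v ↔ ∃ c : ℂ, c ≠ 0 ∧ u.1 = c • v.1
  mul_mem : ∀ {x y : P} (u : DecVec α x) (v : DecVec α y),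
    IsDecomposableVector α (x + y) (u.1 * v.1)
  vec_mul : ∀ {x y : P} (u : DecVec α x) (v : DecVec α y) (w : DecVec α (x + y)),
    w.1 = u.1 * v.1 → vec w = vec u + W.toFun x (vec v)
  scale : ∀ {x : P}, DecVec α x → ℂ
  scale_ne_zero : ∀ {x : P} (u : DecVec α x), scale u ≠ 0
  fiberInner_eq : ∀ {x : P} (u v : DecVec α x),
    fiberInner u.1 v.1 = scale u * starRingEnd ℂ (scale v) * Complex.exp ⟪vec v, vec u⟫_ℂ

namespace LogCoord
variable {α : EndFamily P 𝓗} {W : IsometricRep P K}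

/-- The coordinate of a class of proportional decomposable vectors. -/
def pathVec (c : LogCoord α W) {x : P} (q : PathSpace α x) : K :=
  Quotient.lift (fun u => c.vec u) (fun u v h => (c.vec_eq_iff u v).2 h) q

theorem coproj_vec (c : LogCoord α W) {x : P} (u : DecVec α x) : W.coproj x (c.vec u) = c.vec u :=
  W.coproj_self (c.adj_vec u)

/-- Multiplying by a right factor changes the coordinate only by a vector in the range of `W_y`,
which the projection kills. Thus a left coherent section is a compatible family of projections. -/
theorem coproj_vec_add (c : LogCoord α W) {u : ∀ x : P, DecVec α x} (hu : IsLeftCoherent u)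
    (y z : P) :
    W.coproj y (c.vec (u (y + z))) = c.vec (u y) := by
  obtain ⟨w, hw⟩ := hu y z
  rw [c.vec_mul _ _ _ hw, map_add, coproj_vec, IsometricRep.coproj_apply W y (W.toFun y _),
    IsometricRep.adj_apply_self, sub_self, add_zero]

/-- Through every decomposable vector there passes, up to scalars, a left coherent section. -/
theorem exists_isLeftCoherent (c : LogCoord α W) {x : P} (u : DecVec α x) :
    ∃ s : ∀ x : P, DecVec α x, IsLeftCoherent s ∧ c.vec (s x) = c.vec u := by
  have h1 : ∀ y : P, ∃ v : DecVec α y, c.vec v = W.coproj y (c.vec u) :=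
    fun y => c.exists_vec_eq (W.adj_coproj y _)
  choose s hs using h1
  refine ⟨s, fun y z => ?_, by rw [hs, coproj_vec]⟩
  obtain ⟨w, hw⟩ := c.exists_vec_eq (x := z) (ξ := W.adj y (W.coproj (y + z) (c.vec u)))
    (by rw [← W.adj_add, W.adj_coproj])
  obtain ⟨b, hb, h⟩ := (c.vec_eq_iff (s (y + z)) ⟨(s y).1 * w.1, c.mul_mem _ _⟩).1 (by
    rw [c.vec_mul (s y) w ⟨(s y).1 * w.1, c.mul_mem _ _⟩ rfl, hs, hs, hw, ← W.coproj_coproj_add y z,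
      W.coproj_add_toFun_adj])
  -- Coordinates fix the section only up to scalars; the discrepancy `b` is absorbed into the right
  -- factor.
  refine ⟨⟨b • w.1, w.2.smul hb⟩, ?_⟩
  rw [h, mul_smul_comm]

section Topology
variable {u v : ∀ x : P, DecVec α x}

/-- Near `x` the coordinates of the section are projections of one fixed vector, taken at a point
`a₀` beyond `x`. Continuity thus reduces to that of the projections. -/
theorem exists_coproj_eq_near (c : LogCoord α W) (hu : IsLeftCoherent u) (a₀ : ConeInterior P)
    (x : P)
    (hx : (a₀.1 : E) - x ∈ interior (P : Set E)) :
    ∀ᶠ y in nhds x, c.vec (u y) = W.coproj y (c.vec (u a₀.1)) := by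
  have h : Continuous fun y : P => (a₀.1 : E) - y := by fun_prop
  filter_upwards [h.continuousAt.eventually_mem (isOpen_interior.mem_nhds hx)] with y hy
  have h1 : y + ⟨(a₀.1 : E) - y, interior_subset hy⟩ = a₀.1 := by ext; simp
  rw [← h1, c.coproj_vec_add hu]

theorem continuous_vec (c : LogCoord α W) (hu : IsLeftCoherent u) :
    Continuous fun a : ConeInterior P => c.vec (u a.1) := by
  refine continuous_iff_continuousAt.2 fun a => ?_
  have h1 := c.exists_coproj_eq_near hu (a + a) a.1 (by
    have : ((a + a : ConeInterior P).1 : E) - a.1 = a.1 := add_sub_cancel_right _ _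
    rw [this]; exact a.2)
  have h2 : ContinuousAt (fun y => c.vec (u y)) a.1 :=
    (W.continuous_coproj a _).continuousAt.congr (h1.mono fun y hy => hy.symm)
  exact h2.comp continuous_subtype_val.continuousAt

theorem tendsto_vec_zero (c : LogCoord α W) (hu : IsLeftCoherent u) :
    Filter.Tendsto (fun a : ConeInterior P => c.vec (u a.1))
      (Filter.comap (fun a : ConeInterior P => (a.1 : E)) (nhds 0)) (nhds 0) := by
  by_cases hne : Nonempty (ConeInterior P)
  · obtain ⟨a⟩ := hne
    have h1 := c.exists_coproj_eq_near hu a 0 (by simpa using a.2)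
    have h2 : Filter.Tendsto (fun y => c.vec (u y)) (nhds 0) (nhds 0) := by
      have h3 := (W.continuous_coproj a (c.vec (u a.1))).tendsto 0
      rw [W.coproj_zero] at h3
      exact h3.congr' (h1.mono fun y hy => hy.symm)
    refine h2.comp ?_
    rw [nhds_subtype_eq_comap, Filter.tendsto_comap_iff]
    exact Filter.tendsto_comap
  · rw [not_nonempty_iff] at hne
    exact Filter.tendsto_of_isEmpty

end Topology

/-- The logarithm of the normalised inner product, in coordinates. -/
def logKernel (c : LogCoord α W) (e : ∀ x : P, DecVec α x) : PathKernel α := fun a u v =>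
  ⟪c.pathVec v - c.vec (e a.1), c.pathVec u - c.vec (e a.1)⟫_ℂ

theorem isELogarithm_logKernel (c : LogCoord α W) {e : ∀ x : P, DecVec α x} (he : IsUnitSection e) :
    IsELogarithm e (c.logKernel e) where
  continuous u v hu hv := ((c.continuous_vec hv).sub (c.continuous_vec he.1)).inner
    ((c.continuous_vec hu).sub (c.continuous_vec he.1))
  vanishes u v hu hv := by
    have h := ((c.tendsto_vec_zero hv).sub (c.tendsto_vec_zero he.1)).inner (𝕜 := ℂ)
      ((c.tendsto_vec_zero hu).sub (c.tendsto_vec_zero he.1))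
    rw [sub_zero, inner_zero_left] at h
    exact h
  exp_eq a u v := by
    -- The scalar factors of `u` and `v` cancel; those of `e` leave exactly `⟨eₐ|eₐ⟩`, which is `1`.
    have h1 := he.2 a.1
    rw [c.fiberInner_eq] at h1
    have hu := c.scale_ne_zero u
    have hv : starRingEnd ℂ (c.scale v) ≠ 0 := by simpa using c.scale_ne_zero v
    change Complex.exp ⟪c.vec v - c.vec (e a.1), c.vec u - c.vec (e a.1)⟫_ℂ = _
    rw [c.fiberInner_eq, c.fiberInner_eq, c.fiberInner_eq, inner_sub_left, inner_sub_right,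
      inner_sub_right, Complex.exp_sub, Complex.exp_sub, Complex.exp_sub]
    have he1 := c.scale_ne_zero (e a.1)
    have he2 : starRingEnd ℂ (c.scale (e a.1)) ≠ 0 := by simpa using he1
    have x1 := Complex.exp_ne_zero ⟪c.vec v, c.vec (e a.1)⟫_ℂ
    have x2 := Complex.exp_ne_zero ⟪c.vec (e a.1), c.vec u⟫_ℂ
    have x3 := Complex.exp_ne_zero ⟪c.vec (e a.1), c.vec (e a.1)⟫_ℂ
    field_simp
    linear_combination h1

/-- Two continuous logarithms that agree at the origin agree. -/
theorem eq_of_isELogarithm (c : LogCoord α W) {e : ∀ x : P, DecVec α x} {L L' : PathKernel α}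
    (hL : IsELogarithm e L) (hL' : IsELogarithm e L') : L = L' := by
  funext a p q
  induction p using Quotient.inductionOn with | _ u
  induction q using Quotient.inductionOn with | _ v
  obtain ⟨s, hs, hsu⟩ := c.exists_isLeftCoherent u
  obtain ⟨t, ht, htv⟩ := c.exists_isLeftCoherent v
  have hsu' : pathClass u = pathClass (s a.1) := Quotient.sound ((c.vec_eq_iff _ _).1 hsu.symm)
  have htv' : pathClass v = pathClass (t a.1) := Quotient.sound ((c.vec_eq_iff _ _).1 htv.symm)
  change L a (pathClass u) (pathClass v) = L' a (pathClass u) (pathClass v)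
  rw [hsu', htv']
  -- The open ray joins `a` to the origin inside `Ω`; the difference of the logarithms is followed
  -- along it.
  let γ : Set.Ioi (0 : ℝ) → ConeInterior P := fun r => ⟨ray a.1 r, ray_mem_interior a r.2⟩
  have hγ : Continuous γ :=
    Continuous.subtype_mk ((continuous_ray a.1).comp continuous_subtype_val) _
  let f : Set.Ioi (0 : ℝ) → ℂ := fun r =>
    L (γ r) (pathClass (s (γ r).1)) (pathClass (t (γ r).1)) -
      L' (γ r) (pathClass (s (γ r).1)) (pathClass (t (γ r).1))
  have hf : Continuous f :=
    ((hL.continuous s t hs ht).comp hγ).sub ((hL'.continuous s t hs ht).comp hγ)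
  have hint : ∀ r, ∃ n : ℤ, f r = n * (2 * Real.pi * Complex.I) := by
    intro r
    rw [← Complex.exp_eq_one_iff, Complex.exp_sub, hL.exp_eq, ← hL'.exp_eq,
      div_self (Complex.exp_ne_zero _)]
  have h0 : Filter.Tendsto f (Filter.comap Subtype.val (nhds 0)) (nhds 0) := by
    have h1 : Filter.Tendsto γ (Filter.comap Subtype.val (nhds (0 : ℝ)))
        (Filter.comap (fun a : ConeInterior P => (a.1 : E)) (nhds 0)) := by
      rw [Filter.tendsto_comap_iff]
      have h2 : Continuous fun r : ℝ => (ray a.1 r : E) :=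
        continuous_subtype_val.comp (continuous_ray a.1)
      have h3 := h2.tendsto 0
      simp only [ray_zero, ZeroMemClass.coe_zero] at h3
      exact h3.comp Filter.tendsto_comap
    have h2 := ((hL.vanishes s t hs ht).comp h1).sub ((hL'.vanishes s t hs ht).comp h1)
    rw [sub_zero] at h2
    exact h2
  choose n hn using hint
  have hpi : (2 * Real.pi * Complex.I : ℂ) ≠ 0 := Complex.two_pi_I_ne_zero
  have hcn : Continuous n := by
    have h1 : Continuous fun r => ((n r : ℤ) : ℂ) := by
      have h2 : (fun r => ((n r : ℤ) : ℂ)) = fun r => f r / (2 * Real.pi * Complex.I) := by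
        funext r; rw [hn, mul_div_cancel_right₀ _ hpi]
      rw [h2]; exact hf.div_const _
    have h2 : Continuous fun r => ((n r : ℤ) : ℝ) := by
      simpa [Function.comp_def] using Complex.continuous_re.comp h1
    exact Int.isClosedEmbedding_coe_real.isEmbedding.continuous_iff.2 h2
  -- A continuous integer-valued function on a connected ray is constant; its limit at the origin
  -- then forces it to be zero.
  have hconst : ∀ r r', n r = n r' := by
    have : PreconnectedSpace (Set.Ioi (0 : ℝ)) :=
      isPreconnected_iff_preconnectedSpace.1 isPreconnected_Ioi
    exact fun r r' => PreconnectedSpace.constant inferInstance hcn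
  have hone : γ ⟨1, Set.mem_Ioi.2 one_pos⟩ = a := Subtype.ext (ray_one a.1)
  have hf1 : f ⟨1, Set.mem_Ioi.2 one_pos⟩ = 0 := by
    have hb : (Filter.comap Subtype.val (nhds (0 : ℝ)) : Filter (Set.Ioi (0 : ℝ))).NeBot := by
      have h1 : (nhdsWithin (0 : ℝ) (Set.Ioi 0)).NeBot := inferInstance
      refine Filter.comap_neBot fun U hU => ?_
      obtain ⟨r, hr⟩ := h1.nonempty_of_mem (inter_mem_nhdsWithin (Set.Ioi 0) hU)
      exact ⟨⟨r, hr.1⟩, hr.2⟩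
    have h1 : f = fun _ => f ⟨1, Set.mem_Ioi.2 one_pos⟩ := by
      funext r; rw [hn, hn, hconst r]
    rw [h1] at h0
    exact tendsto_nhds_unique tendsto_const_nhds h0
  have := sub_eq_zero.1 hf1
  rwa [hone] at this

theorem existsUnique_isELogarithm (c : LogCoord α W) {e : ∀ x : P, DecVec α x}
    (he : IsUnitSection e) : ∃! L : PathKernel α, IsELogarithm e L :=
  ⟨_, c.isELogarithm_logKernel he,
    fun _ hL => c.eq_of_isELogarithm hL (c.isELogarithm_logKernel he)⟩

theorem eq_logKernel (c : LogCoord α W) {e : ∀ x : P, DecVec α x} (he : IsUnitSection e)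
    {L : PathKernel α}
    (hL : IsELogarithm e L) : L = c.logKernel e :=
  c.eq_of_isELogarithm hL (c.isELogarithm_logKernel he)

end LogCoord

end LogCoord

/-! ### Realisations of the constructed representation -/

section PathRep

section Unitary
open scoped ComplexOrder
variable {X : Type*} {E F : Type*} [NormedAddCommGroup E] [InnerProductSpace ℂ E]
  [NormedAddCommGroup F] [InnerProductSpace ℂ F] [CompleteSpace F]

theorem exists_clm_of_inner_eq (f : X → E) (g : X → F)
    (hf : Dense (Submodule.span ℂ (Set.range f) : Set E))
    (h : ∀ i j, ⟪f i, f j⟫_ℂ = ⟪g i, g j⟫_ℂ) : ∃ T : E →L[ℂ] F, ∀ x, T (f x) = g x := by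
  refine exists_clm_of_gram_le f g hf 1 zero_le_one ?_
  convert Matrix.PosSemidef.zero using 1
  ext i j
  simp [Matrix.gram_apply, h]

variable [CompleteSpace E]

/-- Total families with the same Gram matrix are unitarily equivalent. -/
theorem exists_linearIsometryEquiv_of_inner_eq (f : X → E) (g : X → F)
    (hf : Dense (Submodule.span ℂ (Set.range f) : Set E))
    (hg : Dense (Submodule.span ℂ (Set.range g) : Set F))
    (h : ∀ i j, ⟪f i, f j⟫_ℂ = ⟪g i, g j⟫_ℂ) : ∃ U : E ≃ₗᵢ[ℂ] F, ∀ x, U (f x) = g x := by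
  obtain ⟨T, hT⟩ := exists_clm_of_inner_eq f g hf h
  obtain ⟨T', hT'⟩ := exists_clm_of_inner_eq g f hg fun i j => (h i j).symm
  have h1 : T ∘L T' = .id ℂ F := clm_ext_of_dense hg fun x => by simp [hT, hT']
  have h2 : T' ∘L T = .id ℂ E := clm_ext_of_dense hf fun x => by simp [hT, hT']
  have h3 : ContinuousLinearMap.adjoint T ∘L T = .id ℂ E := by
    refine clm_ext_of_dense hf fun x => eq_of_inner_eq_of_dense hf fun y => ?_
    rw [ContinuousLinearMap.comp_apply, ContinuousLinearMap.adjoint_inner_right, hT, hT,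
      ContinuousLinearMap.id_apply, h]
  refine ⟨{ toLinearEquiv := LinearEquiv.ofLinearMap T.toLinearMap T'.toLinearMap
              (by ext x; exact DFunLike.congr_fun h1 x) (by ext x; exact DFunLike.congr_fun h2 x)
            norm_map' := fun x => ?_ }, hT⟩
  change ‖T x‖ = ‖x‖
  rw [norm_eq_sqrt_re_inner (𝕜 := ℂ), norm_eq_sqrt_re_inner (𝕜 := ℂ) x,
    ← ContinuousLinearMap.adjoint_inner_right, ← ContinuousLinearMap.comp_apply, h3,
    ContinuousLinearMap.id_apply]

end Unitary

variable {E : Type*} [NormedAddCommGroup E] [NormedSpace ℝ E] {P : PointedCone ℝ E}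
  {𝓗 : Type u} [NormedAddCommGroup 𝓗] [InnerProductSpace ℂ 𝓗] [CompleteSpace 𝓗]
  {K : Type v} [NormedAddCommGroup K] [InnerProductSpace ℂ K] [CompleteSpace K]

theorem ConeInterior.add_comm' (a b : ConeInterior P) : a + b = b + a :=
  Subtype.ext (add_comm a.1 b.1)

/-- The coefficients sum to zero, so recentring is free. Hence the centring of the kernel at `eₐ`
does not affect the form. -/
theorem linearCombination_sub_const {α : EndFamily P 𝓗} {a : ConeInterior P} {M : Type*}
    [AddCommGroup M] [Module ℂ M] (f : zeroSum α a) (φ : PathSpace α a.1 → M) (m : M) :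
    Finsupp.linearCombination ℂ (fun q => φ q - m) f.1 = Finsupp.linearCombination ℂ φ f.1 := by
  have h := LinearMap.mem_ker.1 f.2
  simp only [Finsupp.linearCombination_apply, smul_eq_mul, mul_one] at h
  simp only [Finsupp.linearCombination_apply, smul_sub, Finsupp.sum_sub]
  rw [sub_eq_self, Finsupp.sum, ← Finset.sum_smul]
  exact (congrArg (· • m) h).trans (zero_smul ℂ m)

theorem mem_span_range_pathDiff {α : EndFamily P 𝓗} {a : ConeInterior P} (u₀ : DecVec α a.1)
    (f : zeroSum α a) :
    f ∈ Submodule.span ℂ (Set.range fun u : DecVec α a.1 => pathDiff u u₀) := by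
  let φ : PathSpace α a.1 → zeroSum α a := fun q =>
    ⟨Finsupp.single q 1 - Finsupp.single (pathClass u₀) 1, by simp [zeroSum]⟩
  have h1 : f = Finsupp.linearCombination ℂ φ f.1 := by
    refine Subtype.ext ?_
    have h2 := LinearMap.map_finsupp_linearCombination (zeroSum α a).subtype (g := φ) f.1
    refine Eq.trans ?_ h2.symm
    have h3 := linearCombination_sub_const f (fun q => Finsupp.single q (1 : ℂ))
      (Finsupp.single (pathClass u₀) 1)
    refine Eq.trans ?_ h3.symm
    simp [Finsupp.linearCombination_apply]
  rw [h1, Finsupp.linearCombination_apply]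
  refine Submodule.sum_mem _ fun q _ => Submodule.smul_mem _ _ (Submodule.subset_span ?_)
  induction q using Quotient.inductionOn with | _ u
  exact ⟨u, rfl⟩

namespace IsometricRep
variable (W : IsometricRep P K)

/-- A vector orthogonal to all the `ker Wₐ*` lies in the range of `Wₐ` for every interior `a`. Each
`x ∈ P` lies below the interior point `x + a₀`, so it lies in the range of every `Wₓ`, and purity
makes it zero. -/
theorem dense_span_ker_adj (hW : W.IsPure) (a₀ : ConeInterior P) {S : Set K}
    (hS : ∀ (a : ConeInterior P) ξ, W.adj a.1 ξ = 0 → ξ ∈ S) :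
    Dense (Submodule.span ℂ S : Set K) := by
  rw [Submodule.dense_iff_topologicalClosure_eq_top, Submodule.topologicalClosure_eq_top_iff,
    Submodule.eq_bot_iff]
  intro ζ hζ
  have h1 : ∀ a : ConeInterior P, W.toFun a.1 (W.adj a.1 ζ) = ζ := by
    intro a
    have h2 : ⟪W.coproj a.1 ζ, W.coproj a.1 ζ⟫_ℂ = 0 := by
      rw [← inner_coproj, coproj_coproj]
      exact hζ _ (Submodule.subset_span (hS a _ (W.adj_coproj _ _)))
    exact (sub_eq_zero.1 (inner_self_eq_zero.1 h2)).symm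
  have h2 : ζ ∈ ⋂ x, Set.range (W.toFun x) := by
    refine Set.mem_iInter.2 fun x => ?_
    have h4 := h1 ⟨x + a₀.1, add_mem_interior x a₀⟩
    rw [W.map_add] at h4
    exact ⟨_, h4⟩
  rw [hW] at h2
  exact h2

end IsometricRep

namespace LogCoord
variable {α : EndFamily P 𝓗} {W : IsometricRep P K}

/-- The linear extension of `[u] - [v] ↦ vec u - vec v`. -/
def pathMap (c : LogCoord α W) (a : ConeInterior P) : zeroSum α a →ₗ[ℂ] K :=
  Finsupp.linearCombination ℂ (fun q => c.pathVec q) ∘ₗ (zeroSum α a).subtype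

theorem pathMap_pathDiff (c : LogCoord α W) {a : ConeInterior P} (u v : DecVec α a.1) :
    c.pathMap a (pathDiff u v) = c.vec u - c.vec v := by
  change Finsupp.linearCombination ℂ (fun q => c.pathVec q)
    (Finsupp.single (pathClass u) 1 - Finsupp.single (pathClass v) 1) = _
  rw [map_sub, Finsupp.linearCombination_single, Finsupp.linearCombination_single, one_smul,
    one_smul]
  rfl

theorem inner_pathMap (c : LogCoord α W) (e : ∀ x : P, DecVec α x) (a : ConeInterior P)
    (f g : zeroSum α a) :
    ⟪c.pathMap a g, c.pathMap a f⟫_ℂ = pathForm (c.logKernel e) a f g := by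
  change ⟪Finsupp.linearCombination ℂ (fun q => c.pathVec q) g.1,
    Finsupp.linearCombination ℂ (fun q => c.pathVec q) f.1⟫_ℂ = _
  rw [← linearCombination_sub_const f _ (c.vec (e a.1)),
    ← linearCombination_sub_const g _ (c.vec (e a.1))]
  simp only [Finsupp.linearCombination_apply, pathForm, Finsupp.sum, inner_sum]
  refine Finset.sum_congr rfl fun p _ => ?_
  rw [sum_inner]
  refine Finset.sum_congr rfl fun q _ => ?_
  rw [inner_smul_left, inner_smul_right, logKernel]
  simp only [starRingEnd_apply]
  ring

theorem exists_pathMap_eq (c : LogCoord α W) {a : ConeInterior P} {ξ : K} (h : W.adj a.1 ξ = 0) :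
    ∃ u v : DecVec α a.1, c.vec u - c.vec v = ξ := by
  obtain ⟨u, hu⟩ := c.exists_vec_eq h
  obtain ⟨v, hv⟩ := c.exists_vec_eq (x := a.1) (_root_.map_zero (W.adj a.1))
  exact ⟨u, v, by rw [hu, hv, sub_zero]⟩

theorem isPathRep (c : LogCoord α W) (hW : W.IsPure) (a₀ : ConeInterior P)
    (e : ∀ x : P, DecVec α x) : IsPathRep (c.logKernel e) fun a => W.toFun a.1 := by
  refine ⟨c.pathMap, c.inner_pathMap e, ?_, ?_, ?_⟩
  · intro a d f u v u' v' hu hv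
    rw [pathMap_pathDiff, pathMap_pathDiff, c.vec_mul _ _ _ hu, c.vec_mul _ _ _ hv]
    abel
  · refine (W.dense_span_ker_adj hW a₀ (S := {ξ | ∃ a : ConeInterior P, W.adj a.1 ξ = 0})
      fun a ξ h => ⟨a, h⟩).mono fun ζ hζ => ?_
    -- The kernels are directed, those at `a` and `b` being contained in that at `a + b`, so their
    -- union is already a subspace.
    have h : ∃ a : ConeInterior P, W.adj a.1 ζ = 0 := by
      induction hζ using Submodule.span_induction with
      | zero => exact ⟨a₀, _root_.map_zero _⟩
      | mem x hx => exact hx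
      | smul s x _ hx => obtain ⟨a, ha⟩ := hx; exact ⟨a, by rw [map_smul, ha, smul_zero]⟩
      | add x y _ _ hx hy =>
        obtain ⟨a, ha⟩ := hx
        obtain ⟨b, hb⟩ := hy
        refine ⟨a + b, ?_⟩
        have h1 : W.adj (a + b).1 y = 0 := by
          rw [ConeInterior.add_comm']; exact W.adj_add_eq_zero hb a.1
        have h2 : W.adj (a + b).1 x = 0 := W.adj_add_eq_zero ha b.1
        rw [map_add, h1, h2, add_zero]
    obtain ⟨a, ha⟩ := h
    obtain ⟨u, v, huv⟩ := c.exists_pathMap_eq ha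
    exact Set.mem_iUnion.2 ⟨a, pathDiff u v, by rw [pathMap_pathDiff, huv]⟩
  · intro a b f u v u' v' hu hv
    rw [pathMap_pathDiff, pathMap_pathDiff, c.vec_mul _ _ _ hu, c.vec_mul _ _ _ hv, map_sub]
    abel

/-- The form fixes inner products within one `Hₐ`. Differences at `a` and at `b` are first moved to
`a + b` by right multiplication, which changes neither vector; so the Gram matrices of the total
families agree. -/
theorem exists_unitary_of_isPathRep (c : LogCoord α W) (hW : W.IsPure) (a₀ : ConeInterior P)
    (e : ∀ x : P, DecVec α x) {K' : Type w} [NormedAddCommGroup K'] [InnerProductSpace ℂ K']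
    [CompleteSpace K'] {S : ConeInterior P → K' →ₗᵢ[ℂ] K'} (hS : IsPathRep (c.logKernel e) S) :
    ∃ U : K ≃ₗᵢ[ℂ] K', ∀ (a : ConeInterior P) ξ, U (W.toFun a.1 ξ) = S a (U ξ) := by
  obtain ⟨ι, hform, hemb, hdense, hshift⟩ := hS
  let X := Σ a : ConeInterior P, DecVec α a.1 × DecVec α a.1
  let f : X → K := fun p => c.vec p.2.1 - c.vec p.2.2
  let g : X → K' := fun p => ι p.1 (pathDiff p.2.1 p.2.2)
  have hdec : ∀ x : P, ∃ u : DecVec α x, c.vec u = 0 :=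
    fun x => c.exists_vec_eq (_root_.map_zero (W.adj x))
  have hf : Dense (Submodule.span ℂ (Set.range f) : Set K) := by
    refine W.dense_span_ker_adj hW a₀ fun a ξ h => ?_
    obtain ⟨u, v, huv⟩ := c.exists_pathMap_eq h
    exact ⟨⟨a, u, v⟩, huv⟩
  have hg : Dense (Submodule.span ℂ (Set.range g) : Set K') := by
    refine hdense.mono (Set.iUnion_subset fun a => ?_)
    rintro _ ⟨z, rfl⟩
    obtain ⟨u₀, -⟩ := hdec a.1
    have h1 := Submodule.mem_map_of_mem (f := ι a) (mem_span_range_pathDiff u₀ z)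
    rw [Submodule.map_span, ← Set.range_comp] at h1
    refine Submodule.span_mono ?_ h1
    rintro _ ⟨u, rfl⟩
    exact ⟨⟨a, u, u₀⟩, rfl⟩
  have hsame : ∀ (a : ConeInterior P) (u v u' v' : DecVec α a.1),
      ⟪c.vec u - c.vec v, c.vec u' - c.vec v'⟫_ℂ =
        ⟪ι a (pathDiff u v), ι a (pathDiff u' v')⟫_ℂ := by
    intro a u v u' v'
    rw [hform, ← c.inner_pathMap, pathMap_pathDiff, pathMap_pathDiff]
  have hmove : ∀ (a b d : ConeInterior P), d = a + b → ∀ u v : DecVec α a.1,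
      ∃ u' v' : DecVec α d.1, c.vec u' - c.vec v' = c.vec u - c.vec v ∧
        ι d (pathDiff u' v') = ι a (pathDiff u v) := by
    rintro a b _ rfl u v
    obtain ⟨w, -⟩ := hdec b.1
    let u' : DecVec α (a + b).1 := ⟨u.1 * w.1, c.mul_mem u w⟩
    let v' : DecVec α (a + b).1 := ⟨v.1 * w.1, c.mul_mem v w⟩
    refine ⟨u', v', ?_, hemb a b w u v _ _ rfl rfl⟩
    rw [c.vec_mul u w u' rfl, c.vec_mul v w v' rfl]
    abel
  have hgram : ∀ p q, ⟪f p, f q⟫_ℂ = ⟪g p, g q⟫_ℂ := by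
    rintro ⟨a, u, v⟩ ⟨b, s, t⟩
    obtain ⟨u', v', h1, h2⟩ := hmove a b (a + b) rfl u v
    obtain ⟨s', t', h3, h4⟩ := hmove b a (a + b) (ConeInterior.add_comm' a b) s t
    change ⟪c.vec u - c.vec v, c.vec s - c.vec t⟫_ℂ =
      ⟪ι a (pathDiff u v), ι b (pathDiff s t)⟫_ℂ
    rw [← h1, ← h2, ← h3, ← h4, hsame]
  obtain ⟨U, hU⟩ := exists_linearIsometryEquiv_of_inner_eq f g hf hg hgram
  refine ⟨U, fun a ξ => ?_⟩
  have key : U.toContinuousLinearEquiv.toContinuousLinearMap ∘L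
      (W.toFun a.1).toContinuousLinearMap = (S a).toContinuousLinearMap ∘L
        U.toContinuousLinearEquiv.toContinuousLinearMap := by
    refine clm_ext_of_dense hf ?_
    rintro ⟨b, u, v⟩
    obtain ⟨w, hw⟩ := hdec a.1
    let u' : DecVec α (a + b).1 := ⟨w.1 * u.1, c.mul_mem w u⟩
    let v' : DecVec α (a + b).1 := ⟨w.1 * v.1, c.mul_mem w v⟩
    have h1 : W.toFun a.1 (f ⟨b, u, v⟩) = f ⟨a + b, u', v'⟩ := by
      change W.toFun a.1 (c.vec u - c.vec v) = c.vec u' - c.vec v'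
      rw [c.vec_mul w u u' rfl, c.vec_mul w v v' rfl, map_sub]
      abel
    change U (W.toFun a.1 (f ⟨b, u, v⟩)) = S a (U (f ⟨b, u, v⟩))
    rw [h1, hU, hU]
    exact (hshift a b w u v u' v' rfl rfl).symm
  exact DFunLike.congr_fun key ξ

end LogCoord

end PathRep

/-! ### Logarithmic coordinates of a CCR flow -/

section Coordinates
variable {E : Type*} [NormedAddCommGroup E] [NormedSpace ℝ E] {P : PointedCone ℝ E}
  {H : Type u} [NormedAddCommGroup H] [InnerProductSpace ℂ H] [CompleteSpace H]

namespace IsometricRep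
variable (V : IsometricRep P H)

theorem eq_of_smul_shift_eq {x : P} {ξ η : H} {c d : ℂ} (hc : c ≠ 0)
    (h : c • V.shift x ξ = d • V.shift x η) : V.coproj x ξ = V.coproj x η := by
  refine (eq_of_exp_inner_eq (c := c⁻¹ * d) fun θ => ?_).2
  have h1 := congrArg (fun T : Fock H →L[ℂ] Fock H => ⟪expVec θ, T (expVec 0)⟫_ℂ) h
  simp only [smul_apply, shift_expVec, inner_smul_right, inner_expVec, _root_.map_zero,
    add_zero] at h1
  rw [mul_assoc, ← h1, inv_mul_cancel_left₀ hc]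

/-- The logarithmic coordinates of the decomposable vectors of a CCR flow. -/
def logCoord (a : ConeInterior P) : LogCoord (ccrFlow V) V :=
  have h (x : P) (u : DecVec (ccrFlow V) x) :
      ∃ p : ℂ × H, p.1 ≠ 0 ∧ V.adj x p.2 = 0 ∧ u.1 = p.1 • V.shift x p.2 := by
    obtain ⟨c, hc, ξ, hξ, hu⟩ := V.exists_eq_smul_shift a u.2
    exact ⟨(c, ξ), hc, hξ, hu⟩
  -- The exponent is unique, so the choice made in `vec` can be computed from any representation of
  -- `u` as a multiple of a shift.
  have hvec {x : P} (u : DecVec (ccrFlow V) x) {c : ℂ} {ξ : H} (hξ : V.adj x ξ = 0)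
      (hu : u.1 = c • V.shift x ξ) : (h x u).choose.2 = ξ := by
    obtain ⟨h1, h2, h3⟩ := (h x u).choose_spec
    rw [← V.coproj_self h2, ← V.coproj_self hξ]
    exact V.eq_of_smul_shift_eq h1 (h3.symm.trans hu)
  { vec := fun {x} u => (h x u).choose.2
    scale := fun {x} u => (h x u).choose.1
    adj_vec := fun {x} u => (h x u).choose_spec.2.1
    scale_ne_zero := fun {x} u => (h x u).choose_spec.1
    exists_vec_eq := fun {x ξ} hξ =>
      ⟨⟨V.shift x ξ, V.isDecomposableVector_shift x ξ⟩, hvec _ (c := 1) hξ (one_smul _ _).symm⟩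
    vec_eq_iff := fun {x} u v => by
      obtain ⟨h1, h2, h3⟩ := (h x u).choose_spec
      obtain ⟨k1, k2, k3⟩ := (h x v).choose_spec
      constructor
      · intro huv
        refine ⟨_, div_ne_zero h1 k1, h3.trans (Eq.trans ?_ (congrArg _ k3).symm)⟩
        rw [huv, smul_smul, div_mul_cancel₀ _ k1]
      · rintro ⟨c, -, hc⟩
        exact hvec u (c := c * (h x v).choose.1) k2 (by rw [hc, mul_smul]; exact congrArg _ k3)
    mul_mem := (V.isDecomposable_ccrFlow a).1 _ _
    vec_mul := fun {x y} u v w hw => by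
      obtain ⟨-, h2, h3⟩ := (h x u).choose_spec
      obtain ⟨-, k2, k3⟩ := (h y v).choose_spec
      refine hvec w (c := (h x u).choose.1 * (h y v).choose.1) ?_ ?_
      · rw [_root_.map_add, adj_add, adj_add, h2, adj_apply_self, k2, _root_.map_zero, add_zero]
      · refine hw.trans ((congrArg₂ _ h3 k3).trans ?_)
        rw [smul_mul_smul_comm, shift_mul_shift, V.coproj_self h2, V.coproj_self k2]
    fiberInner_eq := fun {x} u v => by
      obtain ⟨h1, h2, h3⟩ := (h x u).choose_spec
      obtain ⟨k1, k2, k3⟩ := (h x v).choose_spec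
      refine fiberInner_eq_of_star_mul ?_
      refine (congrArg₂ (fun S T => star S * T) k3 h3).trans ?_
      have h4 := star_mul_eq_fiberInner_smul (V.shift_mem_fiber x (h x u).choose.2)
        (V.shift_mem_fiber x (h x v).choose.2)
      rw [fiberInner_shift, V.coproj_self h2, V.coproj_self k2] at h4
      rw [star_smul, smul_mul_smul_comm, h4, smul_smul, starRingEnd_apply,
        mul_comm (star _)] }

end IsometricRep

end Coordinates

/-! ### Transport along cocycle conjugacies -/

section Transport
variable {E : Type*} [NormedAddCommGroup E] [NormedSpace ℝ E] {P : PointedCone ℝ E}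
  {𝓗 : Type u} [NormedAddCommGroup 𝓗] [InnerProductSpace ℂ 𝓗] [CompleteSpace 𝓗]
  {𝓚 : Type v} [NormedAddCommGroup 𝓚] [InnerProductSpace ℂ 𝓚] [CompleteSpace 𝓚]
  {α : EndFamily P 𝓗} {β : EndFamily P 𝓚} {C : P → 𝓗 →L[ℂ] 𝓗}

/-- The map of product systems induced by a cocycle `C` and a unitary `U`. -/
def fiberMap (C : P → 𝓗 →L[ℂ] 𝓗) (U : 𝓗 ≃ₗᵢ[ℂ] 𝓚) (x : P) (T : 𝓗 →L[ℂ] 𝓗) : 𝓚 →L[ℂ] 𝓚 :=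
  U.conjStarAlgEquiv (C x * T)

variable {U : 𝓗 ≃ₗᵢ[ℂ] 𝓚}

theorem IsUnitaryCocycle.star_mul_cancel (hC : IsUnitaryCocycle α C) (x : P) (T : 𝓗 →L[ℂ] 𝓗) :
    star (C x) * (C x * T) = T := by
  rw [← mul_assoc, (Unitary.mem_iff.1 (hC.mem_unitary x)).1, one_mul]

theorem fiberMap_injective (hC : IsUnitaryCocycle α C) (x : P) :
    Function.Injective (fiberMap C U x) := by
  intro S T h
  have h1 := EquivLike.injective U.conjStarAlgEquiv h
  rw [← hC.star_mul_cancel x S, h1, hC.star_mul_cancel]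

theorem fiberMap_surjective (hC : IsUnitaryCocycle α C) (x : P) :
    Function.Surjective (fiberMap C U x) := by
  intro R
  refine ⟨star (C x) * U.conjStarAlgEquiv.symm R, ?_⟩
  rw [fiberMap, ← mul_assoc, (Unitary.mem_iff.1 (hC.mem_unitary x)).2, one_mul,
    StarAlgEquiv.apply_symm_apply]

theorem fiberMap_smul (x : P) (c : ℂ) (T : 𝓗 →L[ℂ] 𝓗) :
    fiberMap C U x (c • T) = c • fiberMap C U x T := by
  rw [fiberMap, mul_smul_comm, map_smul, fiberMap]

theorem fiberMap_mem_iff (hC : IsUnitaryCocycle α C)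
    (hβ : ∀ x A, β x (U.conjStarAlgEquiv A) = U.conjStarAlgEquiv (C x * α x A * star (C x)))
    (x : P) (T : 𝓗 →L[ℂ] 𝓗) : fiberMap C U x T ∈ fiber β x ↔ T ∈ fiber α x := by
  have h1 : ∀ A, β x (U.conjStarAlgEquiv A) * fiberMap C U x T = fiberMap C U x (α x A * T) := by
    intro A
    rw [hβ, fiberMap, fiberMap, ← map_mul, mul_assoc, hC.star_mul_cancel, mul_assoc]
  have h2 : ∀ A, fiberMap C U x T * U.conjStarAlgEquiv A = fiberMap C U x (T * A) := by
    intro A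
    rw [fiberMap, fiberMap, ← map_mul, mul_assoc]
  constructor
  · intro h A
    refine fiberMap_injective (U := U) hC x ?_
    rw [← h1, ← h2]
    exact h _
  · intro h B
    obtain ⟨A, rfl⟩ := EquivLike.surjective U.conjStarAlgEquiv B
    rw [h1, h2, h A]

/-- The cocycle identity produces `α y (C z)` to the left of `S`, and the intertwining relation of
`S` moves it past as `C z`. -/
theorem fiberMap_mul (hC : IsUnitaryCocycle α C) {y : P} (z : P) {S : 𝓗 →L[ℂ] 𝓗}
    (hS : S ∈ fiber α y) (R : 𝓗 →L[ℂ] 𝓗) :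
    fiberMap C U (y + z) (S * R) = fiberMap C U y S * fiberMap C U z R := by
  rw [fiberMap, fiberMap, fiberMap, ← map_mul, hC.map_add, mul_assoc, ← mul_assoc (α y _), hS]
  simp only [mul_assoc]

theorem isDecomposableVector_fiberMap_iff (hC : IsUnitaryCocycle α C)
    (hβ : ∀ x A, β x (U.conjStarAlgEquiv A) = U.conjStarAlgEquiv (C x * α x A * star (C x)))
    (x : P) (T : 𝓗 →L[ℂ] 𝓗) :
    IsDecomposableVector β x (fiberMap C U x T) ↔ IsDecomposableVector α x T := by
  have h0 : fiberMap C U x T = 0 ↔ T = 0 := by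
    have : fiberMap C U x 0 = 0 := by rw [fiberMap, mul_zero, map_zero]
    rw [← this]
    exact (fiberMap_injective hC x).eq_iff
  refine and_congr (fiberMap_mem_iff hC hβ x T) (and_congr (not_congr h0) ?_)
  refine forall_congr' fun y => forall_congr' fun z => forall_congr' fun hyz => ?_
  subst hyz
  constructor
  · rintro ⟨v, hv, w, hw, h⟩
    obtain ⟨S, rfl⟩ := fiberMap_surjective (U := U) hC y v
    obtain ⟨R, rfl⟩ := fiberMap_surjective (U := U) hC z w
    rw [fiberMap_mem_iff hC hβ] at hv hw
    rw [← fiberMap_mul hC z hv] at h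
    exact ⟨S, hv, R, hw, fiberMap_injective hC _ h⟩
  · rintro ⟨v, hv, w, hw, rfl⟩
    exact ⟨_, (fiberMap_mem_iff hC hβ y v).2 hv, _, (fiberMap_mem_iff hC hβ z w).2 hw,
      fiberMap_mul hC z hv w⟩

theorem fiberInner_fiberMap [Nontrivial 𝓚] (hC : IsUnitaryCocycle α C) {x : P}
    {S T : 𝓗 →L[ℂ] 𝓗} (hS : S ∈ fiber α x) (hT : T ∈ fiber α x) :
    fiberInner (fiberMap C U x S) (fiberMap C U x T) = fiberInner S T := by
  refine fiberInner_eq_of_star_mul ?_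
  rw [fiberMap, fiberMap, ← map_star, ← map_mul, star_mul, mul_assoc, hC.star_mul_cancel,
    star_mul_eq_fiberInner_smul hS hT, map_smul, map_one]

/-- Logarithmic coordinates are transported along cocycle conjugacies. -/
def LogCoord.ofCocycle [Nontrivial 𝓚] {K : Type w} [NormedAddCommGroup K] [InnerProductSpace ℂ K]
    [CompleteSpace K] {W : IsometricRep P K} (c : LogCoord β W) (hC : IsUnitaryCocycle α C)
    (hβ : ∀ x A, β x (U.conjStarAlgEquiv A) = U.conjStarAlgEquiv (C x * α x A * star (C x))) :
    LogCoord α W :=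
  let θ {x : P} (u : DecVec α x) : DecVec β x :=
    ⟨fiberMap C U x u.1, (isDecomposableVector_fiberMap_iff hC hβ x u.1).2 u.2⟩
  { vec := fun u => c.vec (θ u)
    scale := fun u => c.scale (θ u)
    adj_vec := fun u => c.adj_vec (θ u)
    scale_ne_zero := fun u => c.scale_ne_zero (θ u)
    exists_vec_eq := fun {x ξ} hξ => by
      obtain ⟨u, hu⟩ := c.exists_vec_eq hξ
      obtain ⟨T, hT⟩ := fiberMap_surjective (U := U) hC x u.1
      refine ⟨⟨T, (isDecomposableVector_fiberMap_iff hC hβ x T).1 (hT ▸ u.2)⟩, ?_⟩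
      rw [← hu]
      exact congrArg c.vec (Subtype.ext hT)
    vec_eq_iff := fun {x} u v => by
      rw [c.vec_eq_iff]
      refine exists_congr fun b => and_congr_right fun _ => ?_
      change fiberMap C U x u.1 = b • fiberMap C U x v.1 ↔ _
      rw [← fiberMap_smul]
      exact (fiberMap_injective hC x).eq_iff
    mul_mem := fun {x y} u v => by
      rw [← isDecomposableVector_fiberMap_iff hC hβ, fiberMap_mul hC y u.2.1]
      exact c.mul_mem (θ u) (θ v)
    vec_mul := fun {x y} u v w hw => by
      refine c.vec_mul (θ u) (θ v) (θ w) ?_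
      change fiberMap C U (x + y) w.1 = _
      rw [hw, fiberMap_mul hC y u.2.1]
    fiberInner_eq := fun u v => by
      rw [← c.fiberInner_eq]
      exact (fiberInner_fiberMap hC u.2.1 v.2.1).symm }

end Transport

/-! ### The two directions of the classification -/

section Main
variable {E : Type*} [NormedAddCommGroup E] [NormedSpace ℝ E] {P : PointedCone ℝ E}
  {H : Type u} [NormedAddCommGroup H] [InnerProductSpace ℂ H]
  {K : Type v} [NormedAddCommGroup K] [InnerProductSpace ℂ K]
  {V : IsometricRep P H} {W : IsometricRep P K}

theorem exists_fockMap (U : H ≃ₗᵢ[ℂ] K) :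
    ∃ Γ : Fock H ≃ₗᵢ[ℂ] Fock K, ∀ ξ, Γ (expVec ξ) = expVec (U ξ) := by
  refine exists_linearIsometryEquiv_of_inner_eq _ _ dense_span_expVec ?_ fun ξ η => ?_
  · have h : Set.range (fun ξ => expVec (U ξ)) = Set.range (expVec (H := K)) :=
      U.surjective.range_comp expVec
    rw [h]
    exact dense_span_expVec
  · rw [inner_expVec, inner_expVec, LinearIsometryEquiv.inner_map_map]

/-- For `x ∈ P` and `c` interior, both `c` and `x + c` are interior, which gives the relation at `x`
on all vectors `V_c ξ`; small `c` and strong continuity give it on `ξ`. -/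
theorem UnitarilyEquivalent.of_coneInterior (a : ConeInterior P) (U : H ≃ₗᵢ[ℂ] K)
    (h : ∀ (b : ConeInterior P) ξ, U (V.toFun b.1 ξ) = W.toFun b.1 (U ξ)) :
    UnitarilyEquivalent V W := by
  refine ⟨U, fun x ξ => ?_⟩
  by_contra hne
  have hopen : IsOpen {y : P | U (V.toFun x (V.toFun y ξ)) ≠ W.toFun x (U (V.toFun y ξ))} := by
    refine isOpen_ne_fun ?_ ?_
    · exact U.continuous.comp ((V.toFun x).continuous.comp (V.continuous ξ))
    · exact (W.toFun x).continuous.comp (U.continuous.comp (V.continuous ξ))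
  obtain ⟨c, hc⟩ := exists_coneInterior_mem a (hopen.mem_nhds (x := 0) (by
    simpa only [Set.mem_ofPred_eq, V.map_zero] using hne))
  apply hc
  have h1 := h ⟨x + c.1, add_mem_interior x c⟩ ξ
  rw [V.map_add, W.map_add, ← h] at h1
  exact h1

variable [CompleteSpace H] [CompleteSpace K]

/-- Cocycle conjugate CCR flows come from unitarily equivalent isometric representations. -/
theorem unitarilyEquivalent_of_cocycleConjugate (a : ConeInterior P) (hV : V.IsPure)
    (hW : W.IsPure) (h : CocycleConjugate (ccrFlow V) (ccrFlow W)) : UnitarilyEquivalent V W := by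
  obtain ⟨C, U, hC, hU⟩ := h
  have hβ : ∀ x A, ccrFlow W x (U.conjStarAlgEquiv A) =
      U.conjStarAlgEquiv (C x * ccrFlow V x A * star (C x)) := by
    intro x A
    refine ContinuousLinearMap.ext fun ζ => ?_
    have h1 := hU x A (U.symm ζ)
    rw [U.apply_symm_apply] at h1
    exact h1
  obtain ⟨e, he⟩ := V.exists_isUnitSection
  -- A second system of coordinates for the same flow `α^V`, with values in the space of `W`.
  have cW : LogCoord (ccrFlow V) W := (W.logCoord a).ofCocycle hC hβ
  have h1 := cW.isPathRep hW a e
  -- By uniqueness both coordinate systems have the same `e`-logarithm, so `W` realises the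
  -- representation constructed from `V`.
  rw [(V.logCoord a).eq_logKernel he (cW.isELogarithm_logKernel he)] at h1
  obtain ⟨U', hU'⟩ := (V.logCoord a).exists_unitary_of_isPathRep hV a e h1
  exact .of_coneInterior a U' hU'

/-- The second quantisation `Γ` of `U` carries the shift by `ξ` to the shift by `U ξ`. The shifts
determine the flows, so `Γ` intertwines them exactly and the cocycle can be trivial. -/
theorem cocycleConjugate_of_unitarilyEquivalent (h : UnitarilyEquivalent V W) :
    CocycleConjugate (ccrFlow V) (ccrFlow W) := by
  obtain ⟨U, hU⟩ := h
  obtain ⟨Γ, hΓ⟩ := exists_fockMap U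
  have hadj : ∀ x ξ, U (V.adj x ξ) = W.adj x (U ξ) := by
    intro x ξ
    refine ext_inner_right ℂ fun η => ?_
    obtain ⟨η, rfl⟩ := U.surjective η
    rw [W.inner_adj_left, ← hU, U.inner_map_map, U.inner_map_map, V.inner_adj_left]
  have hshift : ∀ x ξ ζ, Γ (V.shift x ξ ζ) = W.shift x (U ξ) (Γ ζ) := by
    intro x ξ
    refine DFunLike.congr_fun (clm_ext_of_dense dense_span_expVec
      (S := Γ.toContinuousLinearEquiv.toContinuousLinearMap ∘L V.shift x ξ)
      (T := W.shift x (U ξ) ∘L Γ.toContinuousLinearEquiv.toContinuousLinearMap) fun η => ?_)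
    change Γ (V.shift x ξ (expVec η)) = W.shift x (U ξ) (Γ (expVec η))
    rw [V.shift_expVec, hΓ, hΓ, W.shift_expVec, map_add, hU, V.coproj_apply, W.coproj_apply,
      map_sub, hU, hadj]
  refine ⟨fun _ => 1, Γ, ⟨fun _ => one_mem _, rfl, fun _ _ => by simp, fun _ => by
    simpa using continuous_const⟩, fun x A ξ => ?_⟩
  rw [one_mul, star_one, mul_one]
  have h1 : (ccrFlow W x (Γ.conjStarAlgEquiv A)) ∘L Γ.toContinuousLinearEquiv.toContinuousLinearMap
      = Γ.toContinuousLinearEquiv.toContinuousLinearMap ∘L ccrFlow V x A := by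
    refine clm_ext_of_dense dense_span_expVec fun η => ?_
    change ccrFlow W x (Γ.conjStarAlgEquiv A) (Γ (expVec η)) = Γ (ccrFlow V x A (expVec η))
    have hη : V.shift x η (expVec (V.adj x η)) = expVec η := by
      rw [V.shift_expVec, V.coproj_add_toFun_adj]
    rw [← hη, hshift, ← mul_apply_eq_comp, W.shift_mem_fiber x (U η), ← mul_apply_eq_comp,
      V.shift_mem_fiber x η, mul_apply_eq_comp, mul_apply_eq_comp, hshift,
      LinearIsometryEquiv.conjStarAlgEquiv_apply_apply, Γ.symm_apply_apply]
  exact DFunLike.congr_fun h1 ξ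

/-- A convex set in finite dimension with full affine span has interior points; since `0 ∈ P`, that
span contains all differences `x - y`. -/
theorem nonempty_coneInterior {d : ℕ} (P : PointedCone ℝ (EuclideanSpace ℝ (Fin d)))
    (h : ∀ z : EuclideanSpace ℝ (Fin d), ∃ x ∈ P, ∃ y ∈ P, z = x - y) :
    Nonempty (ConeInterior P) := by
  have hconv : Convex ℝ (P : Set (EuclideanSpace ℝ (Fin d))) := P.convex
  have hspan : affineSpan ℝ (P : Set (EuclideanSpace ℝ (Fin d))) = ⊤ := by
    refine eq_top_iff.2 fun z _ => ?_
    obtain ⟨x, hx, y, hy, rfl⟩ := h z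
    have h1 := (affineSpan ℝ (P : Set (EuclideanSpace ℝ (Fin d)))).smul_vsub_vadd_mem 1
      (subset_affineSpan ℝ _ hx) (subset_affineSpan ℝ _ hy) (subset_affineSpan ℝ _ P.zero_mem)
    simpa using h1
  obtain ⟨a, ha⟩ := hconv.interior_nonempty_iff_affineSpan_eq_top.2 hspan
  exact ⟨⟨⟨a, interior_subset ha⟩, ha⟩⟩

end Main

end CCR

end

theorem mainTheorem2 {d : ℕ} (P : PointedCone ℝ (EuclideanSpace ℝ (Fin d)))
    (hP_closed : IsClosed (P : Set (EuclideanSpace ℝ (Fin d))))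
    (hP_spanning : ∀ z : EuclideanSpace ℝ (Fin d), ∃ x ∈ P, ∃ y ∈ P, z = x - y)
    (hP_pointed : ∀ x ∈ P, -x ∈ P → x = 0)
    {H : Type u} [NormedAddCommGroup H] [InnerProductSpace ℂ H] [CompleteSpace H]
    [TopologicalSpace.SeparableSpace H]
    {K : Type v} [NormedAddCommGroup K] [InnerProductSpace ℂ K] [CompleteSpace K]
    [TopologicalSpace.SeparableSpace K]
    (V : CCR.IsometricRep P H) (W : CCR.IsometricRep P K) (hV : V.IsPure) (hW : W.IsPure) :
    (CCR.CocycleConjugate (CCR.ccrFlow V) (CCR.ccrFlow W) ↔ CCR.UnitarilyEquivalent V W) ∧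
    CCR.IsDecomposable (CCR.ccrFlow V) ∧
    (∃ e : ∀ x : P, CCR.DecVec (CCR.ccrFlow V) x, CCR.IsUnitSection e) ∧
    ∀ e : ∀ x : P, CCR.DecVec (CCR.ccrFlow V) x, CCR.IsUnitSection e →
      (∃! L : CCR.PathKernel (CCR.ccrFlow V), CCR.IsELogarithm e L) ∧
      ∀ L : CCR.PathKernel (CCR.ccrFlow V), CCR.IsELogarithm e L →
        (∃ (K' : Type u) (_ : NormedAddCommGroup K') (_ : InnerProductSpace ℂ K')
          (_ : CompleteSpace K') (S : CCR.ConeInterior P → K' →ₗᵢ[ℂ] K'), CCR.IsPathRep L S) ∧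
        ∀ (K' : Type w) [NormedAddCommGroup K'] [InnerProductSpace ℂ K'] [CompleteSpace K']
          (S : CCR.ConeInterior P → K' →ₗᵢ[ℂ] K'), CCR.IsPathRep L S →
          ∃ U : H ≃ₗᵢ[ℂ] K', ∀ a ξ, U (V.toFun a.1 ξ) = S a (U ξ) := by
  obtain ⟨a⟩ := CCR.nonempty_coneInterior P hP_spanning
  refine ⟨⟨CCR.unitarilyEquivalent_of_cocycleConjugate a hV hW,
    CCR.cocycleConjugate_of_unitarilyEquivalent⟩, V.isDecomposable_ccrFlow a,
    V.exists_isUnitSection, fun e he =>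
    ⟨(V.logCoord a).existsUnique_isELogarithm he, fun L hL => ?_⟩⟩
  obtain rfl := (V.logCoord a).eq_logKernel he hL
  exact ⟨⟨H, inferInstance, inferInstance, inferInstance, _, (V.logCoord a).isPathRep hV a e⟩,
    fun K' _ _ _ S hS => (V.logCoord a).exists_unitary_of_isPathRep hV a e hS⟩
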